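/- **Setting.** Let $G$ be a simple graph on $n\ge 2$ vertices that is initially without edges and undergoes an arbitrary sequence of insertions (of absent edges) and deletions (of present edges). Let $\rho=\max_{\emptyset\ne S\subseteq V}|E[S]|/|S|$ be the maximum subgraph density of the current graph $G$. Put $b=6$, let $G^b$ be $G$ with every edge replaced by $b$ parallel copies, let $\eta>0$, and write $\varepsilon=\eta b^{-1}$, $K=\lceil 128/\varepsilon\rceil$. In an orientation of $G^b$, $d^+(u)$ is the out-degree of $u$ (with multiplicity), and $N^+(u)$, $N^-(u)$ are the sets of out- and in-neighbours. **Algorithm.** For each ordered pair $(u,v)$ the number of copies of $uv$ oriented $u\to v$ is stored, and for each vertex $u$: the number $d^+(u)$; the set $N^+(u)$ in cyclic order with a pointer, for each of two round robins (one checks out-neighbours, the other informs them), new elements being linked in immediately before the pointer; for each $w\in N^-(u)$ a perceived out-degree $d^+_u(w)$; and the linked list, from high to low $j$, of the non-empty buckets $B_j=\{w\in N^-(u): (1+\varepsilon/64)^j\le d^+_u(w)<(1+\varepsilon/64)^{j+1}\}$ (perceived value $0$ is put into $B_0$). *Informing* $w\in N^+(u)$ means setting $d^+_w(u)$ to $d^+(u)$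 and moving $u$ to its new bucket. *Adding* $u\to v$ orients one more copy from $u$ to $v$; a new in-neighbour enters with its current stored out-degree as its perceived value. *Removing* is the inverse. * $\mathrm{Insert}(u\to v)$: add $u\to v$. Visit the next (at most $K$, each at most once) elements $x$ of $N^+(u)$ in the checking round robin. At the first $x$ with $d^+(u)+1>(1+\varepsilon/2)d^+(x)+1$, remove $u\to x$, call $\mathrm{Insert}(x\to u)$ and return; every other visited $x$ is informed. If no such $x$ is found, increase $d^+(u)$ by $1$ and inform the next $K$ elements of $N^+(u)$ (each at most once) in the informing round robin. * $\mathrm{Delete}(u\to v)$: remove $u\to v$. Let $x$ be the first element of the first bucket of $N^-(u)$. If $x$ exists and $d^+_u(x)>(1+\varepsilon/2)(d^+(u)-1)+1$, add $u\to x$ and call $\mathrm{Delete}(x\to u)$. Otherwise decrease $d^+(u)$ by $1$ and inform the next $K$ elements of $N^+(u)$ (each at most once) in the informing round robin. When an edge $uv$ is inserted into $G$, its $b$ copies are inserted one by one, each by $\mathrm{Insert}(u\to v)$ if then $d^+(u)\le d^+(v)$ and by $\mathrm{Insert}(v\to u)$ otherwise; when it is deleted, its $b$ copies are deleted one by one.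 The orientation $\overrightarrow G$ of $G$ directs each edge as the majority of its copies, ties being broken by a fixed order of the vertices. Time is counted in elementary steps: $O(1)$ for each call, comparison, counter or pointer operation, one step for each non-empty bucket passed when an element is moved, and $O(\log n)$ for locating the bucket of a new in-neighbour. **Theorem.** Let $\gamma>0$ and $\kappa>0$ be constants. There is a constant $C$, depending only on $\gamma$ and $\kappa$, such that for all $n\ge2$ and all $\eta$ with $$\frac{\kappa}{\log n}\;\le\;\eta b^{-1}\;<\;\frac{1}{\log n\cdot\max\{\gamma^{-1},1\}}$$ and for every sequence of updates, the algorithm terminates on every update, and after every update it holds an orientation $\overrightarrow G^b$ of $G^b$ and an orientation $\overrightarrow G$ of $G$ such that 1. $d^+(u)\le(1+\eta b^{-1})\,d^+(v)+2$ for every arc $u\to v$ of $\overrightarrow G^b$; 2. every out-degree in $\overrightarrow G^b$ and every out-degree in $\overrightarrow G$ is at most $C(\rho+\log n)$; 3. the update took at most $C\log^2 n\cdot\log(\rho+2)$ steps, where $\rho$ is the maximum subgraph density of $G$ right after the update. -/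

import Mathlib

namespace DynOrient

open Classical in
/-- The maximum subgraph density `ρ` of a finite graph: the maximum of `|E[S]| / |S|` over all sets
`S` of vertices (the empty set contributes `0 / 0 = 0`). -/
noncomputable def maxDensity {n : ℕ} (G : SimpleGraph (Fin n)) : ℝ :=
  ⨆ S : Finset (Fin n), ({e ∈ G.edgeSet | ∀ x ∈ e, x ∈ S}.ncard : ℝ) / (S.card : ℝ)

/-- An update of the dynamic graph. -/
inductive Update (n : ℕ) where
  | insert (u v : Fin n)
  | delete (u v : Fin n)

/-- The update is legal in `G` and turns `G` into `G'`. -/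
def Update.Takes {n : ℕ} : Update n → SimpleGraph (Fin n) → SimpleGraph (Fin n) → Prop
  | .insert u v, G, G' => u ≠ v ∧ ¬ G.Adj u v ∧ G' = G ⊔ SimpleGraph.edge u v
  | .delete u v, G, G' => G.Adj u v ∧ G' = G \ SimpleGraph.edge u v

/-- The parameters: every edge of `G` is duplicated `b` times, `η` is the slack of the invariant, and
`θ` is `1` for the additive invariant (and `0` for the purely multiplicative one). -/
structure Params where
  b : ℕ
  η : ℝ
  θ : ℕ

/-- `η b⁻¹`. -/
noncomputable def Params.eps (P : Params) : ℝ := P.η * (P.b : ℝ)⁻¹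

/-- The number `⌈128 / (η b⁻¹)⌉` of out-neighbours visited by one call of a round robin. -/
noncomputable def Params.width (P : Params) : ℕ := ⌈128 / P.eps⌉₊

/-- The number `j` of the bucket `B_j` that holds the perceived out-degree `p`, that is,
`(1 + η b⁻¹ / 64) ^ j ≤ p < (1 + η b⁻¹ / 64) ^ (j + 1)`. (The value `0` is put into `B_0`.) -/
noncomputable def Params.bucket (P : Params) (p : ℕ) : ℕ :=
  ⌊Real.logb (1 + P.eps / 64) (p : ℝ)⌋₊

/-- The data structure. A list is a (doubly linked) list, with handles to its nodes, so that a node is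
appended or unlinked in constant time. The two round robins over `N⁺(u)` (the one that checks
out-neighbours and the one that informs them) have a cyclic list with a pointer each; a cyclic list is
written from its pointer on. Hence visiting a node moves it from the front to the back, and a new node
that is linked in immediately before the pointer is appended at the back. -/
structure State (n : ℕ) where
  /-- `copies u v` is the number of copies of the edge `uv` that are oriented from `u` to `v` -/
  copies : Fin n → Fin n → ℕ
  /-- the stored out-degree `d⁺(u)` -/
  deg : Fin n → ℕ
  /-- `N⁺(u)`, from the pointer of the checking round robin on -/
  checkList : Fin n → List (Fin n)
  /-- `N⁺(u)`, from the pointer of the informing round robin on -/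
  informList : Fin n → List (Fin n)
  /-- `N⁻(v)`, bucket after bucket, from high to low bucket numbers -/
  inList : Fin n → List (Fin n)
  /-- `perceived v u` is the value `d⁺_v(u)` that `v` holds for the out-degree of `u` -/
  perceived : Fin n → Fin n → ℕ

/-- The data structure of the graph without edges. -/
def State.empty (n : ℕ) : State n where
  copies := fun _ _ => 0
  deg := fun _ => 0
  checkList := fun _ => []
  informList := fun _ => []
  inList := fun _ => []
  perceived := fun _ _ => 0

variable {n : ℕ}

/-- Set `f x y` to `a`. -/
def set₂ (f : Fin n → Fin n → ℕ) (x y : Fin n) (a : ℕ) : Fin n → Fin n → ℕ :=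
  Function.update f x (Function.update (f x) y a)

/-- The number of non-empty buckets of `N⁻(v)` with a number between `i` and `j`: the number of buckets
passed on the way from `B_i` to `B_j` along the linked list of the non-empty buckets. -/
noncomputable def bucketsBetween (P : Params) (s : State n) (v : Fin n) (i j : ℕ) : ℕ :=
  (((s.inList v).map fun w => P.bucket (s.perceived v w)).toFinset.filter
    fun k => min i j ≤ k ∧ k ≤ max i j).card

open Classical in
/-- Set `d⁺_v(u)` to `p` and put `u` at the front of the bucket of `N⁻(v)` where it now belongs. -/
noncomputable def place (P : Params) (s : State n) (v u : Fin n) (p : ℕ) : State n :=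
  let f := set₂ s.perceived v u p
  { s with
    perceived := f
    inList := Function.update s.inList v
      (((s.inList v).erase u).orderedInsert
        (fun x y => P.bucket (f v y) ≤ P.bucket (f v x)) u) }

/-! Every operation below returns the new data structure (and possibly an answer) together with the
number of elementary steps it takes. -/

/-- Update `d⁺_w(u)` to the current value `d⁺(u)` in the linked list `N⁻(w)`. The node of `u` is moved
along the linked list of non-empty buckets, one step for each bucket passed. -/
noncomputable def inform (P : Params) (s : State n) (u w : Fin n) : State n × ℕ :=
  (place P s w u (s.deg u),
    1 + bucketsBetween P s w (P.bucket (s.perceived w u)) (P.bucket (s.deg u)))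

/-- `Add(u → v)`: one more copy of `uv` is oriented from `u` to `v`. If `v` is a new out-neighbour
of `u`, it is linked in immediately before the pointers, and `u` enters `N⁻(v)` with the current value
of `d⁺(u)`. To find the place of its bucket among the non-empty ones, an index of the bucket numbers
is searched, for which a logarithmic number of steps is charged. -/
noncomputable def addCopy (P : Params) (s : State n) (u v : Fin n) : State n × ℕ :=
  let s₁ : State n := { s with copies := set₂ s.copies u v (s.copies u v + 1) }
  if s.copies u v = 0 then
    (place P { s₁ with
        checkList := Function.update s.checkList u (s.checkList u ++ [v])
        informList := Function.update s.informList u (s.informList u ++ [v]) } v u (s.deg u),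
      2 + Nat.log 2 n)
  else (s₁, 1)

/-- `Remove(u → v)`: one copy of `uv` oriented from `u` to `v` is removed; if it was the last one, the
nodes of `v` in `N⁺(u)` and of `u` in `N⁻(v)` are unlinked. -/
def removeCopy (s : State n) (u v : Fin n) : State n × ℕ :=
  let s₁ : State n := { s with copies := set₂ s.copies u v (s.copies u v - 1) }
  if s.copies u v ≤ 1 then
    ({ s₁ with
        checkList := Function.update s.checkList u ((s.checkList u).erase v)
        informList := Function.update s.informList u ((s.informList u).erase v)
        inList := Function.update s.inList v ((s.inList v).erase u) }, 2)
  else (s₁, 1)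

open Classical in
/-- The loop of the insertion: visit the next `k` out-neighbours `x` of `u` in round robin. At the first
one with `d⁺(u) + 1 > (1 + η b⁻¹ / 2) d⁺(x) + θ`, stop and return it; every other one is informed
of `d⁺(u)`. -/
noncomputable def checkNext (P : Params) (s : State n) (u : Fin n) :
    ℕ → (State n × Option (Fin n)) × ℕ
  | 0 => ((s, none), 1)
  | k + 1 =>
    match s.checkList u with
    | [] => ((s, none), 1)
    | x :: l =>
      if (s.deg u : ℝ) + 1 > (1 + P.eps / 2) * (s.deg x : ℝ) + (P.θ : ℝ) then ((s, some x), 1)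
      else
        let r₁ := inform P { s with checkList := Function.update s.checkList u (l ++ [x]) } u x
        let r₂ := checkNext P r₁.1 u k
        (r₂.1, 1 + r₁.2 + r₂.2)

/-- Inform the next `k` out-neighbours of `u`, in round robin, of `d⁺(u)`. -/
noncomputable def informNext (P : Params) (s : State n) (u : Fin n) : ℕ → State n × ℕ
  | 0 => (s, 1)
  | k + 1 =>
    match s.informList u with
    | [] => (s, 1)
    | w :: l =>
      let r₁ := inform P { s with informList := Function.update s.informList u (l ++ [w]) } u w
      let r₂ := informNext P r₁.1 u k
      (r₂.1, 1 + r₁.2 + r₂.2)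

/-- The out-degree of `u` changes to `d`, and the next out-neighbours of `u` are informed; if there are
fewer than the width of the round robin, each is informed once. -/
noncomputable def setDegree (P : Params) (s : State n) (u : Fin n) (d : ℕ) : State n × ℕ :=
  let r := informNext P { s with deg := Function.update s.deg u d } u
    (min P.width (s.informList u).length)
  (r.1, 1 + r.2)

/-- `Insert(u → v)`, the recursive insertion of one copy of an edge. The first number bounds the depth of
the recursion: the value is `none` if there are more nested calls, and otherwise (with a value that no
longer depends on the bound) it is `some (new data structure, number of steps)`. -/
noncomputable def insertCopy (P : Params) : ℕ → State n → Fin n → Fin n → Option (State n × ℕ)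
  | 0, _, _, _ => none
  | depth + 1, s, u, v =>
    let a := addCopy P s u v
    let c := checkNext P a.1 u (min P.width (a.1.checkList u).length)
    match c.1.2 with
    | some x =>
      let r := removeCopy c.1.1 u x
      (insertCopy P depth r.1 x u).bind fun q => some (q.1, 1 + a.2 + c.2 + r.2 + q.2)
    | none =>
      let q := setDegree P c.1.1 u (c.1.1.deg u + 1)
      some (q.1, 1 + a.2 + c.2 + q.2)

open Classical in
/-- The test of the deletion at `u`: the first element `x` of the first bucket of `N⁻(u)`, provided that
`d⁺_u(x) > (1 + η b⁻¹ / 2) (d⁺(u) - 1) + θ`. -/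
noncomputable def heavyInNeighbour (P : Params) (s : State n) (u : Fin n) : Option (Fin n) :=
  match s.inList u with
  | [] => none
  | x :: _ =>
    if (s.perceived u x : ℝ) > (1 + P.eps / 2) * ((s.deg u : ℝ) - 1) + (P.θ : ℝ) then some x
    else none

/-- `Delete(u → v)`, the recursive deletion of one copy of an edge, with the same convention. -/
noncomputable def deleteCopy (P : Params) : ℕ → State n → Fin n → Fin n → Option (State n × ℕ)
  | 0, _, _, _ => none
  | depth + 1, s, u, v =>
    let r := removeCopy s u v
    match heavyInNeighbour P r.1 u with
    | some x =>
      let a := addCopy P r.1 u x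
      (deleteCopy P depth a.1 x u).bind fun q => some (q.1, 2 + r.2 + a.2 + q.2)
    | none =>
      let q := setDegree P r.1 u (r.1.deg u - 1)
      some (q.1, 2 + r.2 + q.2)

/-- Insert `k` copies of the edge `uv` into `G^b`, one by one, each from an endpoint of at most the
out-degree of the other one. -/
noncomputable def insertCopies (P : Params) (depth : ℕ) (u v : Fin n) :
    ℕ → State n → Option (State n × ℕ)
  | 0, s => some (s, 0)
  | k + 1, s =>
    (if s.deg u ≤ s.deg v then insertCopy P depth s u v else insertCopy P depth s v u).bind fun q =>
      (insertCopies P depth u v k q.1).bind fun q' => some (q'.1, 1 + q.2 + q'.2)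

/-- Delete `k` copies of the edge `uv` from `G^b`, one by one. -/
noncomputable def deleteCopies (P : Params) (depth : ℕ) (u v : Fin n) :
    ℕ → State n → Option (State n × ℕ)
  | 0, s => some (s, 0)
  | k + 1, s =>
    (if 0 < s.copies u v then deleteCopy P depth s u v else deleteCopy P depth s v u).bind fun q =>
      (deleteCopies P depth u v k q.1).bind fun q' => some (q'.1, 1 + q.2 + q'.2)

/-- The algorithm on one update of `G`, with a bound on the depth of the recursion. -/
noncomputable def process (P : Params) (depth : ℕ) (s : State n) :
    Update n → Option (State n × ℕ)
  | .insert u v => insertCopies P depth u v P.b s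
  | .delete u v => deleteCopies P depth u v P.b s

/-- On the update `op`, the algorithm terminates; it turns the data structure `s` into `s'` and takes
`t` steps. -/
def Runs (P : Params) (s : State n) (op : Update n) (s' : State n) (t : ℕ) : Prop :=
  ∃ depth, process P depth s op = some (s', t)

theorem insertCopy_mono (P : Params) {d : ℕ} {s : State n} {u v : Fin n} {r : State n × ℕ}
    (h : insertCopy P d s u v = some r) (e : ℕ) : insertCopy P (d + e) s u v = some r := by
  induction d generalizing s u v r with
  | zero => simp [insertCopy] at h
  | succ d ih =>
    rw [Nat.succ_add]
    simp only [insertCopy] at h ⊢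
    split at h
    · obtain ⟨q, hq, h⟩ := Option.bind_eq_some_iff.1 h
      rw [ih hq]
      exact h
    · exact h

theorem deleteCopy_mono (P : Params) {d : ℕ} {s : State n} {u v : Fin n} {r : State n × ℕ}
    (h : deleteCopy P d s u v = some r) (e : ℕ) : deleteCopy P (d + e) s u v = some r := by
  induction d generalizing s u v r with
  | zero => simp [deleteCopy] at h
  | succ d ih =>
    rw [Nat.succ_add]
    simp only [deleteCopy] at h ⊢
    split at h
    · obtain ⟨q, hq, h⟩ := Option.bind_eq_some_iff.1 h
      rw [ih hq]
      exact h
    · exact h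

theorem insertCopies_mono (P : Params) {d k : ℕ} {s : State n} {u v : Fin n} {r : State n × ℕ}
    (h : insertCopies P d u v k s = some r) (e : ℕ) : insertCopies P (d + e) u v k s = some r := by
  induction k generalizing s r with
  | zero => exact h
  | succ k ih =>
    simp only [insertCopies] at h ⊢
    obtain ⟨q, hq, h⟩ := Option.bind_eq_some_iff.1 h
    obtain ⟨q', hq', h⟩ := Option.bind_eq_some_iff.1 h
    have h₁ : (if s.deg u ≤ s.deg v then insertCopy P (d + e) s u v
        else insertCopy P (d + e) s v u) = some q := by
      split_ifs at hq ⊢ <;> exact insertCopy_mono P hq e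
    rw [h₁, Option.bind_some, ih hq']
    exact h

theorem deleteCopies_mono (P : Params) {d k : ℕ} {s : State n} {u v : Fin n} {r : State n × ℕ}
    (h : deleteCopies P d u v k s = some r) (e : ℕ) : deleteCopies P (d + e) u v k s = some r := by
  induction k generalizing s r with
  | zero => exact h
  | succ k ih =>
    simp only [deleteCopies] at h ⊢
    obtain ⟨q, hq, h⟩ := Option.bind_eq_some_iff.1 h
    obtain ⟨q', hq', h⟩ := Option.bind_eq_some_iff.1 h
    have h₁ : (if 0 < s.copies u v then deleteCopy P (d + e) s u v
        else deleteCopy P (d + e) s v u) = some q := by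
      split_ifs at hq ⊢ <;> exact deleteCopy_mono P hq e
    rw [h₁, Option.bind_some, ih hq']
    exact h

/-- The algorithm is deterministic: the outcome and the number of steps are determined by the data
structure and the update. -/
theorem Runs.unique {P : Params} {s s₁ s₂ : State n} {op : Update n} {t₁ t₂ : ℕ}
    (h₁ : Runs P s op s₁ t₁) (h₂ : Runs P s op s₂ t₂) : s₁ = s₂ ∧ t₁ = t₂ := by
  obtain ⟨d₁, h₁⟩ := h₁
  obtain ⟨d₂, h₂⟩ := h₂
  have h : (some (s₁, t₁) : Option (State n × ℕ)) = some (s₂, t₂) := by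
    cases op with
    | insert u v =>
      rw [← insertCopies_mono P h₁ d₂, ← insertCopies_mono P h₂ d₁, Nat.add_comm d₁ d₂]
    | delete u v =>
      rw [← deleteCopies_mono P h₁ d₂, ← deleteCopies_mono P h₂ d₁, Nat.add_comm d₁ d₂]
  simpa using h

/-- `c u v` (the number of copies of `uv` directed from `u` to `v`) is an orientation of `G^b`, the
graph `G` with every edge duplicated `b` times. -/
def IsMultiOrientation (b : ℕ) (G : SimpleGraph (Fin n)) (c : Fin n → Fin n → ℕ) : Prop :=
  ∀ u v, (G.Adj u v → c u v + c v u = b) ∧ (¬ G.Adj u v → c u v = 0)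

/-- The out-degree of `u` in an orientation of a multigraph. -/
def multiOutDegree (c : Fin n → Fin n → ℕ) (u : Fin n) : ℕ := ∑ v, c u v

/-- The directed graph obtained by rounding: `uv` is directed as the majority of its copies, and from
the smaller to the larger vertex in case of a tie. -/
def rounded (c : Fin n → Fin n → ℕ) (u v : Fin n) : Prop :=
  c v u < c u v ∨ (c v u = c u v ∧ 0 < c u v ∧ u < v)

/-- `D` directs every edge of `G` in exactly one way (and has no other arcs). -/
def IsOrientation (G : SimpleGraph (Fin n)) (D : Fin n → Fin n → Prop) : Prop :=
  ∀ u v, (G.Adj u v ↔ D u v ∨ D v u) ∧ ¬ (D u v ∧ D v u)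

/-- The out-degree of `u` in a directed graph. -/
noncomputable def outDegree (D : Fin n → Fin n → Prop) (u : Fin n) : ℕ := {v | D u v}.ncard

end DynOrient

namespace DynOrient
variable {n : ℕ}

/-! Write ε for `P.eps` and K for `P.width`, so that Kε ≥ 128. Both round robins are analysed by
charging an arc x → y for the position of y in the cyclic list of x. `Invariant.balanced` says
K·d(x) + position ≤ K((1+ε)d(y) + 2), and `Invariant.close` says that the perceived value p
satisfies |d − p| + position/K ≤ p/K. When d(x) changes by one, the pointers concerned advance by K:
an element not visited gains K in position, which pays for the change. A visited element has just
passed the stricter test with ε/2 (or has just been informed). Its new position is at most d(x), and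
the slack between ε/2 and ε absorbs this.

On a deletion, the head of the in-list is heaviest up to one bucket, hence up to a factor 1+ε/64. If
it fails the test, every in-neighbour is light up to the small errors of bucketing and staleness,
and the degree may drop.

The recursion follows degrees that shrink (insertion) or grow (deletion, shifted by one) by at least
1 and by a factor at least 1+ε/8. `potential`, which is (32/ε)·log(1+εd), changes by at least 1 per
call, so it bounds the depth. A call costs O(K + log n), because a move between `Near` values passes
at most three non-empty buckets. Stored degrees change only in the last call, so one degree bound
serves the whole recursion.

For the out-degree bound (`exists_threshold`), raise a threshold a ≥ 12ρ+1 to (1+ε)a+2. Arcs leaving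
vertices above the new threshold end above the old one, so counting edges inside the larger set
halves its size. After log₂ n + 1 rounds nothing is left, and (1+ε)^k stays bounded because ε·log n
≤ 1. The same inequality removes log n from inside the potential's logarithm, which leaves log(ρ+2)
in the running time. -/

/-! ### Parameters and bucket numbers. -/

/-- The range of parameters in which the invariants are maintained. -/
structure Params.Admissible (P : Params) : Prop where
  eps_pos : 0 < P.eps
  eps_le : P.eps ≤ 3 / 2
  theta_eq : P.θ = 1

theorem Params.Admissible.le_eps_mul_width {P : Params} (hP : P.Admissible) :
    128 ≤ P.eps * P.width := by
  have h := Nat.le_ceil (128 / P.eps)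
  rw [div_le_iff₀ hP.eps_pos] at h
  rw [mul_comm]
  exact h

theorem Params.Admissible.width_pos {P : Params} (hP : P.Admissible) : 0 < P.width :=
  Nat.ceil_pos.2 (div_pos (by norm_num) hP.eps_pos)

theorem bucket_zero (P : Params) : P.bucket 0 = 0 := by simp [Params.bucket]

theorem bucket_mono {P : Params} (hP : P.Admissible) : Monotone P.bucket := by
  intro p q h
  rcases Nat.eq_zero_or_pos p with rfl | hp
  · simp [bucket_zero]
  · have := hP.eps_pos
    exact Nat.floor_le_floor (Real.logb_le_logb_of_le (by linarith) (by exact_mod_cast hp)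
      (by exact_mod_cast h))

theorem bucket_le_add {P : Params} (hP : P.Admissible) {p q : ℕ} (hp : 0 < p) (m : ℕ)
    (h : (q : ℝ) ≤ (1 + P.eps / 64) ^ m * p) : P.bucket q ≤ P.bucket p + m := by
  rcases Nat.eq_zero_or_pos q with rfl | hq
  · simp [bucket_zero]
  have hε := hP.eps_pos
  have hβ : 1 < 1 + P.eps / 64 := by linarith
  have hp' : (1 : ℝ) ≤ p := by exact_mod_cast hp
  have h₁ : Real.logb (1 + P.eps / 64) q ≤ Real.logb (1 + P.eps / 64) p + m := by
    refine (Real.logb_le_logb_of_le hβ (by exact_mod_cast hq) h).trans_eq ?_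
    rw [Real.logb_mul (by positivity) (by positivity), Real.logb_pow,
      Real.logb_self_eq_one hβ]
    ring
  unfold Params.bucket
  rw [← Nat.floor_add_natCast (Real.logb_nonneg hβ hp')]
  exact Nat.floor_le_floor h₁

/-- A bucket spans a factor 1+ε/64; the maximum with 1 is there because the value 0 shares `B_0`
with 1. -/
theorem le_of_bucket_le {P : Params} (hP : P.Admissible) {p q : ℕ}
    (h : P.bucket q ≤ P.bucket p) : (q : ℝ) ≤ (1 + P.eps / 64) * max (p : ℝ) 1 := by
  have hε := hP.eps_pos
  have hβ : 1 < 1 + P.eps / 64 := by linarith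
  rcases Nat.eq_zero_or_pos q with rfl | hq
  · have : (0 : ℝ) ≤ max (p : ℝ) 1 := le_max_of_le_right zero_le_one
    simp only [Nat.cast_zero]
    positivity
  have hq' : (0 : ℝ) < q := by exact_mod_cast hq
  have h₁ : Real.logb (1 + P.eps / 64) q ≤
      1 + Real.logb (1 + P.eps / 64) (max (p : ℝ) 1) := by
    have h₂ : (P.bucket p : ℝ) ≤ Real.logb (1 + P.eps / 64) (max (p : ℝ) 1) := by
      rcases Nat.eq_zero_or_pos p with rfl | hp
      · simp [bucket_zero]
      · have hp' : (1 : ℝ) ≤ p := by exact_mod_cast hp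
        rw [max_eq_left hp']
        exact Nat.floor_le (Real.logb_nonneg hβ hp')
    have h₃ : Real.logb (1 + P.eps / 64) q < P.bucket q + 1 := Nat.lt_floor_add_one _
    have h₄ : (P.bucket q : ℝ) ≤ P.bucket p := by exact_mod_cast h
    linarith
  have hm : 0 < max (p : ℝ) 1 := lt_max_of_lt_right one_pos
  rw [← Real.logb_le_logb hβ hq' (by positivity), Real.logb_mul (by positivity) hm.ne',
    Real.logb_self_eq_one hβ]
  exact h₁

/-- The perceived out-degree `p` is so close to the out-degree `d` that few buckets lie between. -/
def Near (K p d : ℕ) : Prop := K * d ≤ (K + 1) * p + K ∧ K * p ≤ p + K * d + K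

/-- For p < K the two values differ by at most 1. Their bucket numbers may be far apart, but no
integer lies strictly between them, so only their own two buckets can be non-empty. For p ≥ K they
agree up to (1+ε/64)² one way and 1+ε/64 the other, so the bucket numbers themselves are close. -/
theorem bucketsBetween_le {P : Params} (hP : P.Admissible) {p d : ℕ} (h : Near P.width p d)
    (s : State n) (v : Fin n) : bucketsBetween P s v (P.bucket p) (P.bucket d) ≤ 3 := by
  obtain ⟨h₁, h₂⟩ := h
  have hK := hP.width_pos
  have hε := hP.eps_pos
  have hε' := hP.eps_le
  have hεK := hP.le_eps_mul_width
  unfold bucketsBetween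
  rcases lt_or_ge p P.width with hp | hp
  · have h₃ : d ≤ p + 1 := by
      by_contra! hc
      nlinarith
    have h₄ : p ≤ d + 1 := by
      by_contra! hc
      nlinarith
    refine (Finset.card_le_card (t := {P.bucket p, P.bucket d}) ?_).trans
      (Finset.card_le_two.trans (by norm_num))
    intro k hk
    simp only [Finset.mem_filter, List.mem_toFinset, List.mem_map] at hk
    obtain ⟨⟨w, -, rfl⟩, h₅, h₆⟩ := hk
    set q := s.perceived v w
    simp only [Finset.mem_insert, Finset.mem_singleton]
    rcases le_total p d with hpd | hpd
    · rw [min_eq_left (bucket_mono hP hpd)] at h₅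
      rw [max_eq_right (bucket_mono hP hpd)] at h₆
      rcases Nat.lt_or_ge p q with hq | hq
      · exact Or.inr (h₆.antisymm (bucket_mono hP (by omega)))
      · exact Or.inl ((bucket_mono hP hq).antisymm h₅)
    · rw [min_eq_right (bucket_mono hP hpd)] at h₅
      rw [max_eq_left (bucket_mono hP hpd)] at h₆
      rcases Nat.lt_or_ge d q with hq | hq
      · exact Or.inl (h₆.antisymm (bucket_mono hP (by omega)))
      · exact Or.inr ((bucket_mono hP hq).antisymm h₅)
  · have hp' : (P.width : ℝ) ≤ p := by exact_mod_cast hp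
    have hK' : (0 : ℝ) < P.width := by exact_mod_cast hK
    have h₁' : (P.width : ℝ) * d ≤ (P.width + 1) * p + P.width := by exact_mod_cast h₁
    have h₂' : (P.width : ℝ) * p ≤ p + P.width * d + P.width := by exact_mod_cast h₂
    have hp0 : (0 : ℝ) < p := hK'.trans_le hp'
    have h₃ : (d : ℝ) ≤ (1 + P.eps / 64) * p := by
      refine le_of_mul_le_mul_left ?_ hK'
      nlinarith
    have h₄ : (1 - P.eps / 64) * p ≤ d := by
      refine le_of_mul_le_mul_left ?_ hK'
      nlinarith
    have hd : (0 : ℝ) < d := lt_of_lt_of_le (mul_pos (by linarith) hp0) h₄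
    have h₅ : (p : ℝ) ≤ (1 + P.eps / 64) ^ 2 * d := by
      have : (1 : ℝ) ≤ (1 + P.eps / 64) ^ 2 * (1 - P.eps / 64) := by
        have h : 0 ≤ P.eps / 64 * (1 - P.eps / 64 - (P.eps / 64) ^ 2) :=
          mul_nonneg (by linarith) (by nlinarith)
        linarith
      calc (p : ℝ) = 1 * p := (one_mul _).symm
        _ ≤ (1 + P.eps / 64) ^ 2 * (1 - P.eps / 64) * p := by gcongr
        _ = (1 + P.eps / 64) ^ 2 * ((1 - P.eps / 64) * p) := by ring
        _ ≤ _ := by gcongr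
    have h₆ := bucket_le_add hP (by exact_mod_cast hp0) 1 (by simpa using h₃)
    have h₇ := bucket_le_add hP (by exact_mod_cast hd) 2 h₅
    refine (Finset.card_le_card (t := Finset.Icc (min (P.bucket p) (P.bucket d))
      (max (P.bucket p) (P.bucket d))) ?_).trans ?_
    · intro k hk
      exact Finset.mem_Icc.2 (Finset.mem_filter.1 hk).2
    · rw [Nat.card_Icc]
      omega

/-! ### The potential for the recursion depth. -/

/-- A potential that bounds the depth of the recursion. -/
noncomputable def potential (P : Params) (d : ℝ) : ℝ := 32 / P.eps * Real.log (1 + P.eps * d)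

theorem potential_mono {P : Params} (hP : P.Admissible) {d d' : ℝ} (hd : 0 ≤ d) (h : d ≤ d') :
    potential P d ≤ potential P d' := by
  have := hP.eps_pos
  unfold potential
  gcongr

theorem potential_nonneg {P : Params} (hP : P.Admissible) {d : ℝ} (hd : 0 ≤ d) :
    0 ≤ potential P d := by
  have := hP.eps_pos
  refine (le_of_eq ?_).trans (potential_mono hP le_rfl hd)
  simp [potential]

theorem potential_add_one_le {P : Params} (hP : P.Admissible) {d d' : ℝ} (hd : 0 ≤ d)
    (h₁ : d + 1 ≤ d') (h₂ : (1 + P.eps / 8) * d ≤ d') :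
    potential P d + 1 ≤ potential P d' := by
  have hε := hP.eps_pos
  have hε' := hP.eps_le
  -- This is ε times the average of `h₁` and `h₂`: the additive gain matters below 1/ε, the
  -- multiplicative one above it.
  have h₃ : (1 + P.eps / 16) * (1 + P.eps * d) ≤ 1 + P.eps * d' := by nlinarith
  have h₄ : Real.log (1 + P.eps / 16) + Real.log (1 + P.eps * d) ≤ Real.log (1 + P.eps * d') := by
    rw [← Real.log_mul (by positivity) (by positivity)]
    exact Real.log_le_log (by positivity) h₃
  have h₅ : P.eps / 32 ≤ Real.log (1 + P.eps / 16) := by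
    refine le_trans ?_ (Real.one_sub_inv_le_log_of_pos (by positivity))
    rw [le_sub_comm, inv_le_comm₀ (by positivity) (by linarith), ← one_div,
      div_le_iff₀ (by linarith)]
    nlinarith
  have h₆ : (1 : ℝ) = 32 / P.eps * (P.eps / 32) := by field_simp
  unfold potential
  rw [h₆, ← mul_add]
  simp only [← h₆]
  gcongr
  linarith

/-! ### Positions in cyclic lists, and lists enumerating out-neighbours. -/

section Lists

variable {α : Type*} [DecidableEq α]

/-- The payment of the round robin: advancing the pointer by k moves every element that was not
visited k places closer. -/
theorem idxOf_rotate {l : List α} {k : ℕ} {v : α} (hv : v ∈ l)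
    (h : v ∉ l.take k) : (l.drop k ++ l.take k).idxOf v + min k l.length = l.idxOf v := by
  have h₁ : v ∈ l.drop k := by
    rw [← List.take_append_drop k l, List.mem_append] at hv
    exact hv.resolve_left h
  have h₂ : l.idxOf v = (l.take k ++ l.drop k).idxOf v := by rw [List.take_append_drop]
  rw [h₂, List.idxOf_append_of_mem h₁, List.idxOf_append_of_notMem h, List.length_take]
  omega

theorem idxOf_erase_le (l : List α) {v w : α} (h : w ≠ v) : (l.erase v).idxOf w ≤ l.idxOf w := by
  induction l with
  | nil => simp
  | cons a l ih =>
    rcases eq_or_ne a v with rfl | ha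
    · rw [List.erase_cons_head, List.idxOf_cons_ne _ h.symm]
      omega
    · rw [List.erase_cons_tail (by simpa using ha)]
      rcases eq_or_ne a w with rfl | hw
      · simp
      · rw [List.idxOf_cons_ne _ hw, List.idxOf_cons_ne _ hw]
        omega

end Lists

theorem set₂_apply (f : Fin n → Fin n → ℕ) (x y : Fin n) (a : ℕ) (v w : Fin n) :
    set₂ f x y a v w = if v = x ∧ w = y then a else f v w := by
  unfold set₂
  rcases eq_or_ne v x with rfl | h
  · rcases eq_or_ne w y with rfl | h' <;> simp [*]
  · simp [h]

/-- The lists `L u` enumerate the out-neighbours of `u`. -/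
def Enumerates (L : Fin n → List (Fin n)) (c : Fin n → Fin n → ℕ) : Prop :=
  ∀ u, (L u).Nodup ∧ ∀ v, v ∈ L u ↔ 0 < c u v

theorem Enumerates.length_le {L : Fin n → List (Fin n)} {c : Fin n → Fin n → ℕ}
    (h : Enumerates L c) (u : Fin n) : (L u).length ≤ ∑ v, c u v := by
  rw [← List.toFinset_card_of_nodup (h u).1, Finset.card_eq_sum_ones]
  refine (Finset.sum_le_sum (f := fun _ => 1) (g := c u) fun v hv => ?_).trans
    (Finset.sum_le_sum_of_subset (Finset.subset_univ _))
  exact ((h u).2 v).1 (List.mem_toFinset.1 hv)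

theorem Enumerates.rotate {L : Fin n → List (Fin n)} {c : Fin n → Fin n → ℕ}
    (h : Enumerates L c) (u : Fin n) (k : ℕ) :
    Enumerates (Function.update L u ((L u).drop k ++ (L u).take k)) c := by
  intro w
  rcases eq_or_ne w u with rfl | hw
  · have hp : ((L w).drop k ++ (L w).take k).Perm (L w) :=
      List.perm_append_comm.trans (by rw [List.take_append_drop])
    rw [Function.update_self]
    exact ⟨hp.nodup_iff.2 (h w).1, fun v => hp.mem_iff.trans ((h w).2 v)⟩
  · rw [Function.update_of_ne hw]
    exact h w

theorem Enumerates.add_new {L : Fin n → List (Fin n)} {c : Fin n → Fin n → ℕ}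
    (h : Enumerates L c) {u v : Fin n} (hc : c u v = 0) :
    Enumerates (Function.update L u (L u ++ [v])) (set₂ c u v (c u v + 1)) := by
  intro w
  rcases eq_or_ne w u with rfl | hw
  · rw [Function.update_self]
    have hv : v ∉ L w := fun hv => by simpa [hc] using ((h w).2 v).1 hv
    refine ⟨List.nodup_append.2 ⟨(h w).1, by simp, ?_⟩, fun x => ?_⟩
    · rintro a ha b hb rfl
      rw [List.mem_singleton] at hb
      exact hv (hb ▸ ha)
    · rw [List.mem_append, (h w).2 x, set₂_apply, List.mem_singleton]
      by_cases hx : x = v <;> simp [hx]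
  · rw [Function.update_of_ne hw]
    refine ⟨(h w).1, fun x => ?_⟩
    rw [(h w).2 x, set₂_apply, if_neg (fun h => hw h.1)]

theorem Enumerates.congr {L : Fin n → List (Fin n)} {c : Fin n → Fin n → ℕ}
    (h : Enumerates L c) {u v : Fin n} {a : ℕ} (hc : 0 < c u v) (ha : 0 < a) :
    Enumerates L (set₂ c u v a) := by
  refine fun w => ⟨(h w).1, fun x => ?_⟩
  rw [(h w).2 x, set₂_apply]
  split_ifs with hx
  · rw [hx.1, hx.2]
    exact iff_of_true hc ha
  · rfl

theorem Enumerates.remove_last {L : Fin n → List (Fin n)} {c : Fin n → Fin n → ℕ}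
    (h : Enumerates L c) {u v : Fin n} :
    Enumerates (Function.update L u ((L u).erase v)) (set₂ c u v 0) := by
  intro w
  rcases eq_or_ne w u with rfl | hw
  · rw [Function.update_self]
    refine ⟨(h w).1.erase v, fun x => ?_⟩
    rw [(h w).1.mem_erase_iff, (h w).2 x, set₂_apply]
    by_cases hx : x = v <;> simp [hx]
  · rw [Function.update_of_ne hw]
    refine ⟨(h w).1, fun x => ?_⟩
    rw [(h w).2 x, set₂_apply, if_neg (fun h => hw h.1)]

/-! ### Sorted in-lists and the effect of informing. -/

/-- Every `N⁻(v)` is a list without repetitions, ordered by bucket numbers. -/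
def BucketSorted (P : Params) (s : State n) : Prop :=
  ∀ v, (s.inList v).Nodup ∧
    (s.inList v).Pairwise fun x y => P.bucket (s.perceived v y) ≤ P.bucket (s.perceived v x)

theorem mem_place_inList (P : Params) (s : State n) (v u : Fin n) (p : ℕ) (x w : Fin n)
    (hs : (s.inList v).Nodup) :
    x ∈ (place P s v u p).inList w ↔ (w = v ∧ x = u) ∨ x ∈ s.inList w := by
  classical
  simp only [place]
  rcases eq_or_ne w v with rfl | hw
  · rw [Function.update_self, List.mem_orderedInsert, hs.mem_erase_iff]
    by_cases hx : x = u <;> simp [hx]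
  · rw [Function.update_of_ne hw]
    simp [hw]

theorem BucketSorted.place {P : Params} {s : State n} (h : BucketSorted P s) (v u : Fin n)
    (p : ℕ) : BucketSorted P (place P s v u p) := by
  classical
  intro w
  simp only [DynOrient.place]
  rcases eq_or_ne w v with rfl | hw
  · rw [Function.update_self]
    constructor
    · rw [(List.perm_orderedInsert _ _ _).nodup_iff, List.nodup_cons]
      exact ⟨fun hu => ((h w).1.mem_erase_iff.1 hu).1 rfl, (h w).1.erase u⟩
    · let r : Fin n → Fin n → Prop := fun x y =>
        P.bucket (set₂ s.perceived w u p w y) ≤ P.bucket (set₂ s.perceived w u p w x)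
      have : Std.Total r := ⟨fun a b => le_total _ _⟩
      have : IsTrans (Fin n) r := ⟨fun a b c hab hbc => hbc.trans hab⟩
      refine List.Pairwise.orderedInsert (r := r) u _ ?_
      refine ((h w).2.sublist List.erase_sublist).imp_of_mem fun {a b} ha hb hab => ?_
      have ha' := ((h w).1.mem_erase_iff.1 ha).1
      have hb' := ((h w).1.mem_erase_iff.1 hb).1
      simp only [r, set₂_apply, ha', hb', and_false, if_false]
      exact hab
  · rw [Function.update_of_ne hw]
    simp only [set₂_apply, hw, false_and, if_false]
    exact h w

/-- The state `s'` arises from `s` if `u` informs its out-neighbours in `A`. -/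
structure Informs (P : Params) (s s' : State n) (u : Fin n) (A : List (Fin n)) : Prop where
  copies_eq : s'.copies = s.copies
  deg_eq : s'.deg = s.deg
  perceived_eq : ∀ v w, s'.perceived v w = if w = u ∧ v ∈ A then s.deg u else s.perceived v w
  sorted : BucketSorted P s → BucketSorted P s'
  mem_inList : BucketSorted P s → (∀ v ∈ A, u ∈ s.inList v) →
    ∀ x w, x ∈ s'.inList w ↔ x ∈ s.inList w

theorem Informs.refl (P : Params) (s : State n) (u : Fin n) : Informs P s s u [] :=
  ⟨rfl, rfl, by simp, id, by simp⟩

theorem Informs.cons {P : Params} {s s₀ s' : State n} {u x : Fin n} {A : List (Fin n)}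
    (h : Informs P (inform P s₀ u x).1 s' u A) (hc : s₀.copies = s.copies) (hd : s₀.deg = s.deg)
    (hp : s₀.perceived = s.perceived) (hi : s₀.inList = s.inList) :
    Informs P s s' u (x :: A) := by
  have hs : BucketSorted P s → BucketSorted P s₀ := fun h => by
    unfold BucketSorted
    rw [hi, hp]
    exact h
  refine ⟨h.copies_eq.trans hc, h.deg_eq.trans hd, fun v w => ?_,
    fun hb => h.sorted ((hs hb).place _ _ _), fun hb hA y w => ?_⟩
  · rw [h.perceived_eq]
    simp only [inform, place, set₂_apply, hp, hd, List.mem_cons]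
    by_cases hw : w = u <;> by_cases hv : v = x <;> by_cases hv' : v ∈ A <;> simp [*]
  · have hm := mem_place_inList P s₀ x u (s₀.deg u) (hs := (hs hb x).1)
    rw [h.mem_inList ((hs hb).place _ _ _)]
    · rw [inform, hm, hi]
      constructor
      · rintro (⟨rfl, rfl⟩ | h)
        · exact hA _ List.mem_cons_self
        · exact h
      · exact Or.inr
    · intro v hv
      rw [inform, hm, hi]
      exact Or.inr (hA v (List.mem_cons_of_mem _ hv))

theorem near_self (K d : ℕ) : Near K d d := ⟨by nlinarith, by nlinarith⟩

theorem near_perceived_inform {P : Params} {s : State n} {u x : Fin n} {K : ℕ} {v : Fin n}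
    (h : Near K (s.perceived v u) (s.deg u)) :
    Near K ((inform P s u x).1.perceived v u) ((inform P s u x).1.deg u) := by
  simp only [inform, place, set₂_apply]
  split_ifs
  · exact near_self _ _
  · exact h

/-- The bound on k ensures that no element is visited twice. Each visit costs at most 5: one for the
loop, one for informing, three for the buckets passed. -/
theorem informNext_spec {P : Params} (hP : P.Admissible) (u : Fin n) (k : ℕ) (s : State n)
    (hk : k ≤ (s.informList u).length)
    (hs : ∀ v ∈ s.informList u, Near P.width (s.perceived v u) (s.deg u)) :
    Informs P s (informNext P s u k).1 u ((s.informList u).take k) ∧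
    (informNext P s u k).1.checkList = s.checkList ∧
    (informNext P s u k).1.informList = Function.update s.informList u
      ((s.informList u).drop k ++ (s.informList u).take k) ∧
    (informNext P s u k).2 ≤ 1 + 5 * k := by
  induction k generalizing s with
  | zero => exact ⟨by simpa [informNext] using Informs.refl P s u, rfl, by simp [informNext],
      by simp [informNext]⟩
  | succ k ih =>
    cases hl : s.informList u with
    | nil => simp [hl] at hk
    | cons x l =>
      rw [hl] at hk hs
      simp only [List.length_cons, Nat.add_le_add_iff_right] at hk
      simp only [informNext, hl]
      set s₀ : State n := { s with informList := Function.update s.informList u (l ++ [x]) }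
      have hL : (inform P s₀ u x).1.informList = Function.update s.informList u (l ++ [x]) := rfl
      have hL' : (inform P s₀ u x).1.informList u = l ++ [x] := by rw [hL, Function.update_self]
      obtain ⟨h₁, h₂, h₃, h₄⟩ := ih (inform P s₀ u x).1 (by rw [hL']; simp; omega) (by
        intro v hv
        rw [hL'] at hv
        exact near_perceived_inform (hs v (by simpa [or_comm] using hv)))
      rw [hL', List.take_append_of_le_length hk] at h₁
      rw [hL', List.take_append_of_le_length hk, List.drop_append_of_le_length hk, hL,
        Function.update_idem] at h₃
      refine ⟨?_, h₂, ?_, ?_⟩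
      · rw [List.take_succ_cons]
        exact h₁.cons rfl rfl rfl rfl
      · rw [h₃]
        simp
      · have : bucketsBetween P s₀ x (P.bucket (s₀.perceived x u)) (P.bucket (s₀.deg u)) ≤ 3 :=
          bucketsBetween_le hP (hs x List.mem_cons_self) s₀ x
        simp only [inform] at h₄ ⊢
        omega

/-- Here j counts the elements that passed the test. An element that fails it stops the loop with
the pointer still in front of it. -/
theorem checkNext_spec {P : Params} (hP : P.Admissible) (u : Fin n) (k : ℕ) (s : State n)
    (hk : k ≤ (s.checkList u).length)
    (hs : ∀ v ∈ s.checkList u, Near P.width (s.perceived v u) (s.deg u)) :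
    ∃ j ≤ k, Informs P s (checkNext P s u k).1.1 u ((s.checkList u).take j) ∧
    (checkNext P s u k).1.1.informList = s.informList ∧
    (checkNext P s u k).1.1.checkList = Function.update s.checkList u
      ((s.checkList u).drop j ++ (s.checkList u).take j) ∧
    (checkNext P s u k).2 ≤ 1 + 5 * k ∧
    (∀ x ∈ (s.checkList u).take j,
      (s.deg u : ℝ) + 1 ≤ (1 + P.eps / 2) * (s.deg x : ℝ) + (P.θ : ℝ)) ∧
    (∀ x, (checkNext P s u k).1.2 = some x → x ∈ s.checkList u ∧
      (s.deg u : ℝ) + 1 > (1 + P.eps / 2) * (s.deg x : ℝ) + (P.θ : ℝ)) ∧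
    ((checkNext P s u k).1.2 = none → j = k) := by
  induction k generalizing s with
  | zero => exact ⟨0, le_rfl, by simpa [checkNext] using Informs.refl P s u, rfl, by simp [checkNext],
      by simp [checkNext], by simp, by simp [checkNext], by simp⟩
  | succ k ih =>
    cases hl : s.checkList u with
    | nil => simp [hl] at hk
    | cons x l =>
      rw [hl] at hk hs
      simp only [List.length_cons, Nat.add_le_add_iff_right] at hk
      simp only [checkNext, hl]
      split_ifs with hx
      · refine ⟨0, Nat.zero_le _, by simpa using Informs.refl P s u, rfl, by simp [← hl],
          by simp, by simp, ?_, by simp⟩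
        rintro y hy
        obtain rfl : x = y := by simpa using hy
        exact ⟨List.mem_cons_self, hx⟩
      set s₀ : State n := { s with checkList := Function.update s.checkList u (l ++ [x]) }
      have hL : (inform P s₀ u x).1.checkList = Function.update s.checkList u (l ++ [x]) := rfl
      have hL' : (inform P s₀ u x).1.checkList u = l ++ [x] := by rw [hL, Function.update_self]
      obtain ⟨j, hj, h₁, h₂, h₃, h₄, h₅, h₆, h₇⟩ :=
        ih (inform P s₀ u x).1 (by rw [hL']; simp; omega) (by
          intro v hv
          rw [hL'] at hv
          exact near_perceived_inform (hs v (by simpa [or_comm] using hv)))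
      have hjl := hj.trans hk
      rw [hL', List.take_append_of_le_length hjl] at h₁ h₅
      rw [hL', List.take_append_of_le_length hjl, List.drop_append_of_le_length hjl, hL,
        Function.update_idem] at h₃
      refine ⟨j + 1, by omega, ?_, h₂, ?_, ?_, ?_, ?_, ?_⟩
      · rw [List.take_succ_cons]
        exact h₁.cons rfl rfl rfl rfl
      · rw [h₃]
        simp
      · have : bucketsBetween P s₀ x (P.bucket (s₀.perceived x u)) (P.bucket (s₀.deg u)) ≤ 3 :=
          bucketsBetween_le hP (hs x List.mem_cons_self) s₀ x
        simp only [inform] at h₄ ⊢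
        omega
      · intro y hy
        rw [List.take_succ_cons, List.mem_cons] at hy
        rcases hy with rfl | hy
        · exact not_lt.1 hx
        · exact h₅ y hy
      · intro y hy
        obtain ⟨h, h'⟩ := h₆ y hy
        rw [hL'] at h
        exact ⟨by simpa [or_comm] using h, h'⟩
      · intro h
        rw [h₇ h]

/-! ### The invariants and their behaviour under the elementary operations. -/

/-- The invariants of the data structure while the number of copies directed out of `u` exceeds the
stored out-degree of `u` by `a`. -/
structure Invariant (P : Params) (s : State n) (u : Fin n) (a : ℤ) : Prop where
  loopless : ∀ x, s.copies x x = 0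
  check : Enumerates s.checkList s.copies
  inform : Enumerates s.informList s.copies
  sorted : BucketSorted P s
  mem_inList : ∀ x y, x ∈ s.inList y ↔ 0 < s.copies x y
  sum_copies : ∀ x, ((∑ y, s.copies x y : ℕ) : ℤ) = s.deg x + if x = u then a else 0
  -- The position of y counts how soon y is checked again, and each K places still to go reserve
  -- room for one more increase of the degree of x.
  balanced : ∀ x y, 0 < s.copies x y → (P.width : ℝ) * s.deg x + (s.checkList x).idxOf y ≤
    P.width * ((1 + P.eps) * s.deg y + 2)
  -- The perceived value may be off by a fraction 1/K of itself, minus the drift still possible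
  -- before y is next informed.
  close : ∀ x y, 0 < s.copies x y →
    P.width * s.deg x + (s.informList x).idxOf y ≤ (P.width + 1) * s.perceived y x ∧
    P.width * s.perceived y x + (s.informList x).idxOf y ≤ s.perceived y x + P.width * s.deg x

theorem Invariant.switch {P : Params} {s : State n} {u : Fin n} (h : Invariant P s u 0)
    (v : Fin n) : Invariant P s v 0 :=
  { h with sum_copies := by simpa using h.sum_copies }

theorem Invariant.ne {P : Params} {s : State n} {u : Fin n} {a : ℤ} (h : Invariant P s u a)
    {x y : Fin n} (hc : 0 < s.copies x y) : x ≠ y := by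
  rintro rfl
  rw [h.loopless] at hc
  exact hc.false

theorem Invariant.deg_eq {P : Params} {s : State n} {u : Fin n} (h : Invariant P s u 0)
    (x : Fin n) : ∑ y, s.copies x y = s.deg x := by
  have := h.sum_copies x
  simp only [ite_self, add_zero] at this
  exact_mod_cast this

theorem Enumerates.idxOf_lt {L : Fin n → List (Fin n)} {c : Fin n → Fin n → ℕ}
    (h : Enumerates L c) {x y : Fin n} (hc : 0 < c x y) : (L x).idxOf y < ∑ z, c x z :=
  (List.idxOf_lt_length_of_mem (((h x).2 y).2 hc)).trans_le (h.length_le x)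

theorem sum_set₂ (c : Fin n → Fin n → ℕ) (u v : Fin n) (b : ℕ) (x : Fin n) :
    ((∑ y, set₂ c u v b x y : ℕ) : ℤ) =
      ((∑ y, c x y : ℕ) : ℤ) + if x = u then (b : ℤ) - c u v else 0 := by
  by_cases hx : x = u
  · subst hx
    rw [if_pos rfl, ← Finset.add_sum_erase _ _ (Finset.mem_univ v),
      ← Finset.add_sum_erase Finset.univ (c x) (Finset.mem_univ v)]
    rw [Finset.sum_congr rfl (g := c x) (fun y hy => by
      rw [set₂_apply, if_neg (fun h => (Finset.mem_erase.1 hy).1 h.2)])]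
    rw [set₂_apply, if_pos ⟨rfl, rfl⟩]
    push_cast
    ring
  · simp [set₂_apply, hx]

/-- A new out-neighbour enters last, at a position equal to the list length, which `ha` bounds by
the stored degree of u. With `hd` and Kε ≥ 128 this fits into the slack of `balanced`; for `close`
the perceived value is exact. -/
theorem Invariant.addCopy {P : Params} (hP : P.Admissible) {s : State n} {u v : Fin n} {a : ℤ}
    (h : Invariant P s u a) (ha : a ≤ 0) (huv : u ≠ v) (hd : s.deg u ≤ s.deg v) :
    Invariant P (addCopy P s u v).1 u (a + 1) ∧ (addCopy P s u v).1.deg = s.deg ∧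
      (addCopy P s u v).1.copies = set₂ s.copies u v (s.copies u v + 1) ∧
      (addCopy P s u v).2 ≤ 2 + Nat.log 2 n := by
  have hsum : ∀ x, ((∑ y, set₂ s.copies u v (s.copies u v + 1) x y : ℕ) : ℤ) =
      s.deg x + if x = u then a + 1 else 0 := fun x => by
    rw [sum_set₂, h.sum_copies]
    split_ifs
    · push_cast
      ring
    · simp
  have hloop : ∀ x, set₂ s.copies u v (s.copies u v + 1) x x = 0 := fun x => by
    rw [set₂_apply, if_neg (fun hx => huv (hx.1.symm.trans hx.2)), h.loopless]
  have hlen : ∀ L, Enumerates L s.copies → (L u).length ≤ s.deg u := fun L hL => by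
    have h₁ := hL.length_le u
    have h₂ := h.sum_copies u
    rw [if_pos rfl] at h₂
    omega
  unfold DynOrient.addCopy
  split_ifs with hc
  · refine ⟨⟨hloop, h.check.add_new hc, h.inform.add_new hc, BucketSorted.place ?_ _ _ _,
      fun x y => ?_, hsum, fun x y hxy => ?_, fun x y hxy => ?_⟩, rfl, rfl, le_rfl⟩
    · exact h.sorted
    · refine (mem_place_inList _ _ _ _ _ _ _ (h.sorted v).1).trans ?_
      simp only [place, set₂_apply, h.mem_inList]
      by_cases hx : x = u <;> by_cases hy : y = v <;> simp [*]
    · simp only [place, set₂_apply] at hxy ⊢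
      by_cases hx : x = u
      · subst hx
        rw [Function.update_self]
        by_cases hy : y = v
        · subst hy
          have hn : y ∉ s.checkList x := fun hm => by simpa [hc] using ((h.check x).2 y).1 hm
          rw [List.idxOf_append_of_notMem hn, List.idxOf_cons_self, add_zero]
          have h₁ : ((s.checkList x).length : ℝ) ≤ s.deg x := by
            exact_mod_cast hlen _ h.check
          have h₂ : (s.deg x : ℝ) ≤ s.deg y := by exact_mod_cast hd
          have h₃ := hP.le_eps_mul_width
          have h₄ : (0 : ℝ) ≤ P.width := Nat.cast_nonneg _
          have h₅ : (0 : ℝ) ≤ s.deg y := Nat.cast_nonneg _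
          have h₆ := mul_le_mul_of_nonneg_left h₂ h₄
          have h₇ := mul_le_mul_of_nonneg_right h₃ h₅
          linarith
        · rw [if_neg (fun h => hy h.2)] at hxy
          rw [List.idxOf_append_of_mem (((h.check x).2 y).2 hxy)]
          exact h.balanced x y hxy
      · rw [if_neg (fun h => hx h.1)] at hxy
        rw [Function.update_of_ne hx]
        exact h.balanced x y hxy
    · simp only [place, set₂_apply] at hxy ⊢
      by_cases hx : x = u
      · subst hx
        rw [Function.update_self]
        by_cases hy : y = v
        · subst hy
          have hn : y ∉ s.informList x := fun hm => by simpa [hc] using ((h.inform x).2 y).1 hm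
          rw [List.idxOf_append_of_notMem hn, List.idxOf_cons_self, add_zero,
            if_pos ⟨rfl, rfl⟩]
          have := hlen _ h.inform
          constructor <;> linarith
        · rw [if_neg (fun h => hy h.2)] at hxy
          rw [List.idxOf_append_of_mem (((h.inform x).2 y).2 hxy), if_neg (fun h => hy h.1)]
          exact h.close x y hxy
      · rw [if_neg (fun h => hx h.1)] at hxy
        rw [Function.update_of_ne hx, if_neg (fun h => hx h.2)]
        exact h.close x y hxy
  · have hc' : 0 < s.copies u v := Nat.pos_of_ne_zero hc
    have hpos : ∀ x y, 0 < set₂ s.copies u v (s.copies u v + 1) x y ↔ 0 < s.copies x y := by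
      intro x y
      rw [set₂_apply]
      split_ifs with hx
      · simp [hx.1, hx.2, hc']
      · rfl
    refine ⟨⟨hloop, h.check.congr hc' (Nat.succ_pos _), h.inform.congr hc' (Nat.succ_pos _),
      h.sorted, fun x y => ?_, hsum, fun x y hxy => ?_, fun x y hxy => ?_⟩, rfl, rfl,
      by simp only []; omega⟩
    · exact (h.mem_inList x y).trans (hpos x y).symm
    · exact h.balanced x y ((hpos x y).1 hxy)
    · exact h.close x y ((hpos x y).1 hxy)

/-- Erasing an entry can only lower the positions of the others, and positions occur only on the
smaller sides of the inequalities. -/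
theorem Invariant.removeCopy {P : Params} {s : State n} {u v : Fin n} {a : ℤ}
    (h : Invariant P s u a) (hc : 0 < s.copies u v) :
    Invariant P (removeCopy s u v).1 u (a - 1) ∧ (removeCopy s u v).1.deg = s.deg ∧
      (removeCopy s u v).1.perceived = s.perceived ∧
      (removeCopy s u v).1.copies = set₂ s.copies u v (s.copies u v - 1) ∧
      (removeCopy s u v).2 ≤ 2 := by
  have hsum : ∀ x, ((∑ y, set₂ s.copies u v (s.copies u v - 1) x y : ℕ) : ℤ) =
      s.deg x + if x = u then a - 1 else 0 := fun x => by
    rw [sum_set₂, h.sum_copies]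
    split_ifs
    · push_cast [Nat.cast_sub (Nat.succ_le_of_lt hc)]
      ring
    · simp
  have hpos : ∀ x y, 0 < set₂ s.copies u v (s.copies u v - 1) x y → 0 < s.copies x y := by
    intro x y hxy
    rw [set₂_apply] at hxy
    split_ifs at hxy with hx
    · rwa [hx.1, hx.2]
    · exact hxy
  have hloop : ∀ x, set₂ s.copies u v (s.copies u v - 1) x x = 0 := fun x => by
    by_contra hx
    exact h.ne (hpos x x (Nat.pos_of_ne_zero hx)) rfl
  unfold DynOrient.removeCopy
  split_ifs with h₁
  · have h₀ : s.copies u v - 1 = 0 := by omega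
    simp only [h₀] at hpos hloop hsum ⊢
    have hidx : ∀ (L : Fin n → List (Fin n)) x y, 0 < set₂ s.copies u v 0 x y →
        (Function.update L u ((L u).erase v) x).idxOf y ≤ (L x).idxOf y := by
      intro L x y hxy
      rcases eq_or_ne x u with rfl | hx
      · rw [Function.update_self]
        refine idxOf_erase_le _ ?_
        rintro rfl
        simp [set₂_apply] at hxy
      · rw [Function.update_of_ne hx]
    refine ⟨⟨hloop, h.check.remove_last, h.inform.remove_last, fun w => ?_, fun x y => ?_, hsum,
      fun x y hxy => ?_, fun x y hxy => ?_⟩, trivial, trivial, trivial, le_rfl⟩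
    · rcases eq_or_ne w v with rfl | hw
      · simp only [Function.update_self]
        exact ⟨(h.sorted w).1.erase u, (h.sorted w).2.sublist List.erase_sublist⟩
      · simp only [Function.update_of_ne hw]
        exact h.sorted w
    · simp only [set₂_apply]
      rcases eq_or_ne y v with rfl | hy
      · rw [Function.update_self, (h.sorted y).1.mem_erase_iff, h.mem_inList]
        by_cases hx : x = u <;> simp [hx]
      · rw [Function.update_of_ne hy, h.mem_inList]
        simp [hy]
    · have h₂ : ((Function.update s.checkList u ((s.checkList u).erase v) x).idxOf y : ℝ) ≤
        (s.checkList x).idxOf y := by exact_mod_cast hidx s.checkList x y hxy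
      have h₃ := h.balanced x y (hpos x y hxy)
      simp only []
      linarith
    · have h₂ := hidx s.informList x y hxy
      have h₃ := h.close x y (hpos x y hxy)
      simp only []
      omega
  · have hpos' : ∀ x y, 0 < s.copies x y → 0 < set₂ s.copies u v (s.copies u v - 1) x y := by
      intro x y hxy
      rw [set₂_apply]
      split_ifs with hx
      · omega
      · exact hxy
    have h₂ : 0 < s.copies u v - 1 := by omega
    refine ⟨⟨hloop, h.check.congr hc h₂, h.inform.congr hc h₂, h.sorted, fun x y => ?_, hsum,
      fun x y hxy => ?_, fun x y hxy => ?_⟩, rfl, rfl, rfl, by simp⟩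
    · exact (h.mem_inList x y).trans ⟨hpos' x y, hpos x y⟩
    · exact h.balanced x y (hpos x y hxy)
    · exact h.close x y (hpos x y hxy)

/-- The tolerance of one is needed because `setDegree` changes the degree before it informs. -/
theorem Invariant.near {P : Params} {s : State n} {u x y : Fin n} {a : ℤ}
    (h : Invariant P s u a) (hc : 0 < s.copies x y) {d : ℕ} (h₁ : d ≤ s.deg x + 1)
    (h₂ : s.deg x ≤ d + 1) : Near P.width (s.perceived y x) d := by
  obtain ⟨h₃, h₄⟩ := h.close x y hc
  constructor <;> nlinarith

theorem Invariant.idxOf_le_deg {P : Params} {s : State n} {u : Fin n} {a : ℤ}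
    (h : Invariant P s u a) (ha : a ≤ 1) {L : Fin n → List (Fin n)} (hL : Enumerates L s.copies)
    {x y : Fin n} (hc : 0 < s.copies x y) : (L x).idxOf y ≤ s.deg x := by
  have h₁ := hL.idxOf_lt hc
  have h₂ := h.sum_copies x
  split_ifs at h₂ <;> omega

theorem Invariant.checkNext {P : Params} (hP : P.Admissible) {s : State n} {u : Fin n}
    (h : Invariant P s u 1) {c : (State n × Option (Fin n)) × ℕ}
    (hc : c = checkNext P s u (min P.width (s.checkList u).length)) :
    Invariant P c.1.1 u 1 ∧ c.1.1.deg = s.deg ∧ c.1.1.copies = s.copies ∧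
      c.2 ≤ 1 + 5 * P.width ∧
      (∀ x, c.1.2 = some x → 0 < s.copies u x ∧
        (s.deg u : ℝ) > (1 + P.eps / 2) * s.deg x) ∧
      (c.1.2 = none → ∀ x, 0 < s.copies u x →
        (P.width : ℝ) * (s.deg u + 1) + (c.1.1.checkList u).idxOf x ≤
          P.width * ((1 + P.eps) * s.deg x + 2)) := by
  have hε := hP.eps_pos
  have hεK := hP.le_eps_mul_width
  have hK : (0 : ℝ) ≤ P.width := Nat.cast_nonneg _
  obtain ⟨j, hj, h₁, h₂, h₃, h₄, h₅, h₆, h₇⟩ := checkNext_spec hP u _ s (min_le_right _ _)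
    (fun v hv => h.near (((h.check u).2 v).1 hv) (Nat.le_succ _) (Nat.le_succ _))
  rw [← hc] at h₁ h₂ h₃ h₄ h₆ h₇
  have hθ := hP.theta_eq
  have hA : ∀ v ∈ (s.checkList u).take j, 0 < s.copies u v := fun v hv =>
    ((h.check u).2 v).1 (List.mem_of_mem_take hv)
  have hcheck : Enumerates c.1.1.checkList s.copies := by
    rw [h₃]
    exact h.check.rotate u j
  -- The test leaves a slack of K(ε/2)d(v) ≥ 64·d(v), while the new position is at most d(u) ≤
  -- 2·d(v).
  have hvisited : ∀ v ∈ (s.checkList u).take j,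
      (P.width : ℝ) * (s.deg u + 1) + (c.1.1.checkList u).idxOf v ≤
          P.width * ((1 + P.eps) * s.deg v + 2) := by
    intro v hv
    have h₈ : ((c.1.1.checkList u).idxOf v : ℝ) ≤ s.deg u := by
      exact_mod_cast h.idxOf_le_deg le_rfl hcheck (hA v hv)
    have h₉ := h₅ v hv
    rw [hθ, Nat.cast_one] at h₉
    have hu : (s.deg u : ℝ) ≤ (1 + P.eps / 2) * s.deg v := by linarith
    have hv0 : (0 : ℝ) ≤ s.deg v := Nat.cast_nonneg _
    have h₁₀ : (s.deg u : ℝ) ≤ 2 * s.deg v := by nlinarith [hP.eps_le]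
    nlinarith
  refine ⟨⟨?_, ?_, ?_, h₁.sorted h.sorted, fun x y => ?_, ?_, ?_, ?_⟩, h₁.deg_eq, h₁.copies_eq,
    ?_, ?_, ?_⟩
  · rw [h₁.copies_eq]
    exact h.loopless
  · rw [h₁.copies_eq]
    exact hcheck
  · rw [h₁.copies_eq, h₂]
    exact h.inform
  · rw [h₁.mem_inList h.sorted (fun v hv => (h.mem_inList u v).2 (hA v hv)), h₁.copies_eq]
    exact h.mem_inList x y
  · rw [h₁.copies_eq, h₁.deg_eq]
    exact h.sum_copies
  · rw [h₁.copies_eq, h₁.deg_eq]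
    intro x y hxy
    rcases eq_or_ne x u with rfl | hx
    · by_cases hy : y ∈ (s.checkList x).take j
      · have := hvisited y hy
        linarith
      · have h₈ := idxOf_rotate (((h.check x).2 y).2 hxy) hy
        have h₉ : (((s.checkList x).drop j ++ (s.checkList x).take j).idxOf y : ℝ) ≤
            (s.checkList x).idxOf y := by
          exact_mod_cast (Nat.le_add_right _ _).trans h₈.le
        have := h.balanced x y hxy
        rw [h₃, Function.update_self]
        linarith
    · rw [h₃, Function.update_of_ne hx]
      exact h.balanced x y hxy
  · rw [h₁.copies_eq, h₁.deg_eq, h₂]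
    intro x y hxy
    rw [h₁.perceived_eq]
    split_ifs with hx
    · obtain ⟨rfl, -⟩ := hx
      have := h.idxOf_le_deg le_rfl h.inform hxy
      constructor <;> linarith
    · exact h.close x y hxy
  · have := min_le_left P.width (s.checkList u).length
    omega
  · intro x hx
    obtain ⟨h₈, h₉⟩ := h₆ x hx
    rw [hθ, Nat.cast_one] at h₉
    exact ⟨((h.check u).2 x).1 h₈, by linarith⟩
  · intro hn x hx
    by_cases hv : x ∈ (s.checkList u).take j
    · exact hvisited x hv
    · have hm := ((h.check u).2 x).2 hx
      have h₈ := idxOf_rotate hm hv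
      have h₉ : j < (s.checkList u).length := by
        by_contra! hlt
        rw [List.take_of_length_le hlt] at hv
        exact hv hm
      -- An element was left out, so the list is longer than K and the full K elements were visited;
      -- the drop of K in position pays for the extra degree.
      have h₁₀ : j = P.width := by
        have := h₇ hn
        omega
      rw [min_eq_left h₉.le, h₁₀] at h₈
      have h₁₁ := h.balanced u x hx
      rw [← h₈] at h₁₁
      push_cast at h₁₁
      rw [h₃, Function.update_self, h₁₀]
      linarith

/-- Only `close` needs an argument, since `hb` supplies the balance. Informed neighbours hold the
exact value and have position below d; the others gain K in position, and the degree moves by at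
most one. -/
theorem Invariant.setDegree {P : Params} (hP : P.Admissible) {s : State n} {u : Fin n} {a : ℤ}
    (h : Invariant P s u a) {d : ℕ} (hd : (d : ℤ) = s.deg u + a) (ha : a ≤ 1) (ha' : -1 ≤ a)
    (hb : ∀ x y, 0 < s.copies x y →
      (P.width : ℝ) * Function.update s.deg u d x + (s.checkList x).idxOf y ≤
        P.width * ((1 + P.eps) * Function.update s.deg u d y + 2)) :
    Invariant P (setDegree P s u d).1 u 0 ∧ (setDegree P s u d).1.copies = s.copies ∧
      (setDegree P s u d).2 ≤ 2 + 5 * P.width := by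
  set s₀ : State n := { s with deg := Function.update s.deg u d } with hs₀
  have hdu : s₀.deg u = d := Function.update_self ..
  obtain ⟨h₁, h₂, h₃, h₄⟩ := informNext_spec hP u (min P.width (s.informList u).length) s₀
    (min_le_right _ _) (fun v hv => by
      rw [hdu]
      exact h.near (((h.inform u).2 v).1 hv) (by omega) (by omega))
  simp only [DynOrient.setDegree, ← hs₀]
  set s' := (informNext P s₀ u (min P.width (s.informList u).length)).1
  have hA : ∀ v ∈ (s.informList u).take (min P.width (s.informList u).length),
      0 < s.copies u v := fun v hv => ((h.inform u).2 v).1 (List.mem_of_mem_take hv)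
  have hsum : ∀ x, ((∑ y, s.copies x y : ℕ) : ℤ) = s₀.deg x := by
    intro x
    rw [h.sum_copies]
    split_ifs with hx
    · rw [hx, hdu, hd]
    · simp [s₀, hx]
  have hinform : Enumerates s'.informList s.copies := by
    rw [h₃]
    exact h.inform.rotate u _
  refine ⟨⟨?_, ?_, ?_, h₁.sorted h.sorted, fun x y => ?_, fun x => ?_, fun x y hxy => ?_,
    fun x y hxy => ?_⟩, h₁.copies_eq, ?_⟩
  · rw [h₁.copies_eq]
    exact h.loopless
  · rw [h₁.copies_eq, h₂]
    exact h.check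
  · rw [h₁.copies_eq]
    exact hinform
  · rw [h₁.mem_inList h.sorted (fun v hv => (h.mem_inList u v).2 (hA v hv)), h₁.copies_eq]
    exact h.mem_inList x y
  · rw [h₁.copies_eq, h₁.deg_eq, hsum]
    simp
  · rw [h₁.copies_eq] at hxy
    rw [h₁.deg_eq, h₂]
    exact hb x y hxy
  · rw [h₁.copies_eq] at hxy
    rw [h₁.deg_eq, h₁.perceived_eq]
    rcases eq_or_ne x u with rfl | hx
    · rw [hdu]
      split_ifs with hy
      · have := hinform.idxOf_lt hxy
        have h₆ : ∑ z, s.copies x z = d := by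
          have h₇ := hsum x
          rw [hdu] at h₇
          exact_mod_cast h₇
        rw [h₆] at this
        constructor <;> linarith
      · have hm := ((h.inform x).2 y).2 hxy
        have hy' : y ∉ (s.informList x).take (min P.width (s.informList x).length) :=
          fun h => hy ⟨rfl, h⟩
        have h₆ := idxOf_rotate hm hy'
        have h₇ : P.width < (s.informList x).length := by
          by_contra! hlt
          rw [min_eq_right hlt, List.take_length] at hy'
          exact hy' hm
        rw [min_eq_left h₇.le, min_eq_left h₇.le] at h₆
        obtain ⟨h₈, h₉⟩ := h.close x y hxy
        rw [h₃, Function.update_self]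
        simp only [s₀, min_eq_left h₇.le]
        have h₁₀ : d ≤ s.deg x + 1 := by omega
        have h₁₁ : s.deg x ≤ d + 1 := by omega
        have h₁₂ := Nat.mul_le_mul_left P.width h₁₀
        have h₁₃ := Nat.mul_le_mul_left P.width h₁₁
        constructor <;> linarith
    · rw [if_neg (fun h => hx h.1), h₃, Function.update_of_ne hx]
      simp only [s₀, Function.update_of_ne hx]
      exact h.close x y hxy
  · have := min_le_left P.width (s.informList u).length
    omega

/-! ### Recursive insertion and deletion of one copy. -/

/-- The indicator function of the edge `uv`. -/
def edgeIndicator (u v x y : Fin n) : ℕ := if (x = u ∧ y = v) ∨ (x = v ∧ y = u) then 1 else 0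

theorem edgeIndicator_comm (u v x y : Fin n) : edgeIndicator u v x y = edgeIndicator v u x y := by
  simp only [edgeIndicator, or_comm]

/-- The two summands k and l cover both adding and removing a copy without truncated subtraction. -/
theorem set₂_add_set₂ {c : Fin n → Fin n → ℕ} {u v : Fin n} (huv : u ≠ v) {a k l : ℕ}
    (h : a + k = c u v + l) (x y : Fin n) :
    set₂ c u v a x y + set₂ c u v a y x + k * edgeIndicator u v x y =
      c x y + c y x + l * edgeIndicator u v x y := by
  simp only [set₂_apply, edgeIndicator]
  by_cases h₁ : x = u ∧ y = v
  · obtain ⟨rfl, rfl⟩ := h₁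
    simp [huv.symm]
    omega
  · by_cases h₂ : x = v ∧ y = u
    · obtain ⟨rfl, rfl⟩ := h₂
      simp [huv.symm]
      omega
    · have h₃ : ¬(y = u ∧ x = v) := fun h => h₂ h.symm
      simp [h₁, h₂, h₃]

/-- A bound for the number of steps of one call, apart from the recursive one. -/
noncomputable def callCost (P : Params) (n : ℕ) : ℕ := 6 + Nat.log 2 n + 10 * P.width

/-- Adding u → v and removing u → x cancel in the out-degree of u, so the recursive call starts from
a state without excess and with the same stored degrees, at a vertex x of smaller degree. -/
theorem insertCopy_spec {P : Params} (hP : P.Admissible) {s : State n} {u v : Fin n}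
    (h : Invariant P s u 0) (huv : u ≠ v) (hd : s.deg u ≤ s.deg v) :
    ∃ depth s' t, insertCopy P depth s u v = some (s', t) ∧ Invariant P s' u 0 ∧
      (∀ x y, s'.copies x y + s'.copies y x =
        s.copies x y + s.copies y x + edgeIndicator u v x y) ∧
      (t : ℝ) ≤ callCost P n * (potential P (s.deg u) + 1) := by
  have hε := hP.eps_pos
  induction hm : s.deg u using Nat.strong_induction_on generalizing s u v with
  | _ m ih =>
  subst hm
  obtain ⟨ha, had, hac, hat⟩ := h.addCopy hP le_rfl huv hd
  obtain ⟨hc, hcd, hcc, hct, hsome, hnone⟩ := ha.checkNext hP rfl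
  have hpair := set₂_add_set₂ (c := s.copies) huv (a := s.copies u v + 1) (k := 0)
    (l := 1) (by omega)
  simp only [zero_mul, add_zero, one_mul] at hpair
  have hcost : (0 : ℝ) ≤ callCost P n := Nat.cast_nonneg _
  set a := DynOrient.addCopy P s u v
  set c := DynOrient.checkNext P a.1 u (min P.width (a.1.checkList u).length) with hcdef
  cases hx : c.1.2 with
  | none =>
    have hb : ∀ x y, 0 < c.1.1.copies x y →
        (P.width : ℝ) * (Function.update c.1.1.deg u (c.1.1.deg u + 1) x : ℕ) +
          (c.1.1.checkList x).idxOf y ≤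
        P.width * ((1 + P.eps) * (Function.update c.1.1.deg u (c.1.1.deg u + 1) y : ℕ) + 2) := by
      intro x y hxy
      rcases eq_or_ne x u with rfl | hxu
      · rw [Function.update_self, Function.update_of_ne (hc.ne hxy).symm, hcd]
        rw [hcc] at hxy
        push_cast
        exact hnone hx y hxy
      · rw [Function.update_of_ne hxu]
        refine (hc.balanced x y hxy).trans ?_
        gcongr
        rcases eq_or_ne y u with rfl | hyu
        · rw [Function.update_self]
          exact Nat.le_succ _
        · rw [Function.update_of_ne hyu]
    obtain ⟨hq, hqc, hqt⟩ := hc.setDegree hP (d := c.1.1.deg u + 1) (by simp) le_rfl (by simp) hb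
    refine ⟨1, _, _, by simp only [insertCopy, ← hcdef, a, hx]; rfl, hq, fun x y => ?_, ?_⟩
    · rw [hqc, hcc, hac]
      exact hpair x y
    · have h₁ : 1 + a.2 + c.2 + (DynOrient.setDegree P c.1.1 u (c.1.1.deg u + 1)).2 ≤
          callCost P n := by
        unfold callCost
        omega
      have h₂ := potential_nonneg hP (Nat.cast_nonneg (s.deg u))
      refine (Nat.cast_le.2 h₁).trans ?_
      nlinarith
  | some x =>
    obtain ⟨hux, hlt⟩ := hsome x hx
    rw [had] at hlt
    rw [← hcc] at hux
    obtain ⟨hr, hrd, -, hrc, hrt⟩ := hc.removeCopy hux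
    have hne := hc.ne hux
    set r := DynOrient.removeCopy c.1.1 u x with hrdef
    have hx0 : (0 : ℝ) ≤ s.deg x := Nat.cast_nonneg _
    have hxu : s.deg x < s.deg u := by
      have : (s.deg x : ℝ) < s.deg u := by nlinarith
      exact_mod_cast this
    have hdr : r.1.deg = s.deg := hrd.trans (hcd.trans had)
    rw [show (1 : ℤ) - 1 = 0 by norm_num] at hr
    obtain ⟨depth, s', t, hs', hi, hp, ht⟩ := ih (r.1.deg x) (by rw [hdr]; exact hxu)
      (hr.switch x) hne.symm (by rw [hdr]; exact hxu.le) rfl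
    refine ⟨depth + 1, s', 1 + a.2 + c.2 + r.2 + t, ?_, hi.switch u, fun y z => ?_, ?_⟩
    · simp only [insertCopy]
      rw [← hcdef]
      simp only [hx]
      rw [← hrdef, hs']
      rfl
    · have h₁ := set₂_add_set₂ (c := c.1.1.copies) hne (a := c.1.1.copies u x - 1) (k := 1)
        (l := 0) (by omega) y z
      rw [hp, hrc, edgeIndicator_comm x u]
      rw [hcc, hac] at h₁ ⊢
      have := hpair y z
      omega
    · have h₁ : 1 + a.2 + c.2 + r.2 ≤ callCost P n := by
        unfold callCost
        omega
      have h₂ : ((1 + a.2 + c.2 + r.2 : ℕ) : ℝ) ≤ callCost P n := Nat.cast_le.2 h₁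
      rw [hdr] at ht
      have h₃ : potential P (s.deg x) + 1 ≤ potential P (s.deg u) :=
        potential_add_one_le hP hx0 (by exact_mod_cast hxu) (by nlinarith)
      have h₄ := mul_le_mul_of_nonneg_left h₃ hcost
      rw [Nat.cast_add]
      linarith

theorem mem_of_heavyInNeighbour {P : Params} {s : State n} {u x : Fin n}
    (h : heavyInNeighbour P s u = some x) : x ∈ s.inList u ∧
      (s.perceived u x : ℝ) > (1 + P.eps / 2) * ((s.deg u : ℝ) - 1) + (P.θ : ℝ) := by
  unfold heavyInNeighbour at h
  split at h
  · simp at h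
  · rename_i y l hl
    split_ifs at h with hy
    obtain rfl : y = x := by simpa using h
    exact ⟨hl ▸ List.mem_cons_self, hy⟩

/-- Only the head of the in-list is tested, but it lies in the highest bucket and so bounds all
perceived values up to one bucket width. -/
theorem perceived_le_of_heavyInNeighbour_eq_none {P : Params} (hP : P.Admissible) {s : State n}
    {u w : Fin n} (hs : BucketSorted P s) (h : heavyInNeighbour P s u = none)
    (hd : 1 ≤ s.deg u) (hw : w ∈ s.inList u) :
    (s.perceived u w : ℝ) ≤
      (1 + P.eps / 64) * ((1 + P.eps / 2) * ((s.deg u : ℝ) - 1) + 1) := by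
  have hε := hP.eps_pos
  have hd' : (1 : ℝ) ≤ s.deg u := by exact_mod_cast hd
  unfold heavyInNeighbour at h
  split at h
  · rename_i hl
    simp [hl] at hw
  · rename_i y l hl
    split_ifs at h with hy
    rw [hP.theta_eq, Nat.cast_one, gt_iff_lt, not_lt] at hy
    have hsort := (hs u).2
    rw [hl, List.pairwise_cons] at hsort
    have hb : P.bucket (s.perceived u w) ≤ P.bucket (s.perceived u y) := by
      rw [hl, List.mem_cons] at hw
      rcases hw with rfl | hw
      · exact le_rfl
      · exact hsort.1 w hw
    refine (le_of_bucket_le hP hb).trans ?_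
    gcongr
    refine max_le hy ?_
    nlinarith

/-- Turns a test on a possibly stale value into growth of true degrees, with e = d(u) − 1 and d =
d(x). For p < K staleness can only underestimate d; for p ≥ K it costs a factor 1 − ε/128, which
reduces ε/2 to no less than ε/8. -/
theorem growth_of_heavy {P : Params} (hP : P.Admissible) {p d e : ℕ}
    (hclose : P.width * p ≤ p + P.width * d)
    (hp : (p : ℝ) > (1 + P.eps / 2) * e + 1) :
    e + 2 ≤ d ∧ (1 + P.eps / 8) * e ≤ (d : ℝ) - 1 := by
  have hε := hP.eps_pos
  have hε' := hP.eps_le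
  have hεK := hP.le_eps_mul_width
  have he : (0 : ℝ) ≤ e := Nat.cast_nonneg _
  suffices h : (e : ℝ) + 1 < d ∧ (1 + P.eps / 8) * e ≤ (d : ℝ) - 1 by
    refine ⟨?_, h.2⟩
    have : e + 1 < d := by exact_mod_cast h.1
    omega
  rcases lt_or_ge p P.width with hpK | hpK
  · have h₁ : p ≤ d := by
      by_contra! hc
      nlinarith
    have h₂ : (p : ℝ) ≤ d := by exact_mod_cast h₁
    have h₃ : 0 ≤ P.eps * e := by positivity
    constructor <;> nlinarith
  · have hK : (85 : ℝ) ≤ P.width := by nlinarith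
    have hK' : (0 : ℝ) < P.width := by linarith
    have hpK' : (P.width : ℝ) ≤ p := by exact_mod_cast hpK
    have hc : (P.width : ℝ) * p ≤ p + P.width * d := by exact_mod_cast hclose
    have h₁ : (1 - P.eps / 128) * p ≤ d := by
      refine le_of_mul_le_mul_left ?_ hK'
      have := mul_le_mul_of_nonneg_right hεK (Nat.cast_nonneg (α := ℝ) p)
      linarith
    rcases Nat.eq_zero_or_pos e with rfl | he1
    · norm_num at *
      constructor <;> nlinarith
    · have he1' : (1 : ℝ) ≤ e := by exact_mod_cast he1
      have h₂ : (1 - P.eps / 128) * ((1 + P.eps / 2) * e + 1) ≤ d :=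
        (mul_le_mul_of_nonneg_left hp.le (by linarith)).trans h₁
      have h₃ : (1 + P.eps / 8) * e ≤ (d : ℝ) - 1 := by
        have : 0 ≤ P.eps * ((3 / 8 - 1 / 128 - P.eps / 256) * e - 1 / 128) :=
            mul_nonneg hε.le (by nlinarith)
        linarith
      constructor
      · nlinarith
      · exact h₃

/-- Degrees grow along the recursion, so the depth is measured by the potential left below D. The
shift by one comes from the test, which compares with the degree after the decrease. -/
theorem deleteCopy_spec {P : Params} (hP : P.Admissible) {D : ℕ} {s : State n} {u v : Fin n}
    (h : Invariant P s u 0) (hc : 0 < s.copies u v) (hD : ∀ w, s.deg w ≤ D) :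
    ∃ depth s' t, deleteCopy P depth s u v = some (s', t) ∧ Invariant P s' u 0 ∧
      (∀ x y, s'.copies x y + s'.copies y x + edgeIndicator u v x y =
        s.copies x y + s.copies y x) ∧
      (t : ℝ) ≤ callCost P n * (potential P D - potential P ((s.deg u : ℝ) - 1) + 1) := by
  have hε := hP.eps_pos
  have hε' := hP.eps_le
  have hεK := hP.le_eps_mul_width
  have hK : (0 : ℝ) ≤ P.width := Nat.cast_nonneg _
  have hcost : (0 : ℝ) ≤ callCost P n := Nat.cast_nonneg _
  induction hm : D - s.deg u using Nat.strong_induction_on generalizing s u v with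
  | _ m ih =>
  subst hm
  have hd1 : 1 ≤ s.deg u := by
    rw [← h.deg_eq u]
    exact hc.trans_le (Finset.single_le_sum (f := s.copies u) (fun _ _ => Nat.zero_le _)
      (Finset.mem_univ v))
  have hd1' : (1 : ℝ) ≤ s.deg u := by exact_mod_cast hd1
  have he : ((s.deg u - 1 : ℕ) : ℝ) = (s.deg u : ℝ) - 1 := by rw [Nat.cast_sub hd1, Nat.cast_one]
  obtain ⟨hr, hrd, hrp, hrc, hrt⟩ := h.removeCopy hc
  have hpair := set₂_add_set₂ (c := s.copies) (h.ne hc) (a := s.copies u v - 1) (k := 1) (l := 0)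
    (by omega)
  simp only [zero_mul, add_zero, one_mul] at hpair
  set r := DynOrient.removeCopy s u v with hrdef
  cases hx : heavyInNeighbour P r.1 u with
  | none =>
    have hb : ∀ x y, 0 < r.1.copies x y →
        (P.width : ℝ) * (Function.update r.1.deg u (r.1.deg u - 1) x : ℕ) +
          (r.1.checkList x).idxOf y ≤
        P.width * ((1 + P.eps) * (Function.update r.1.deg u (r.1.deg u - 1) y : ℕ) + 2) := by
      intro x y hxy
      rcases eq_or_ne y u with rfl | hyu
      · have hxu := hr.ne hxy
        rw [Function.update_of_ne hxu, Function.update_self, hrd, he]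
        have h₁ := perceived_le_of_heavyInNeighbour_eq_none hP hr.sorted hx (by rwa [hrd])
          ((hr.mem_inList x y).2 hxy)
        rw [hrd] at h₁
        have h₂ : ((r.1.checkList x).idxOf y : ℝ) ≤ s.deg x := by
          rw [← hrd]
          exact_mod_cast hr.idxOf_le_deg (by norm_num) hr.check hxy
        have h₃ : (P.width : ℝ) * s.deg x ≤ (P.width + 1) * r.1.perceived y x := by
          have := (Nat.le_add_right _ _).trans (hr.close x y hxy).1
          rw [hrd] at this
          exact_mod_cast this
        have hx0 : (0 : ℝ) ≤ s.deg x := Nat.cast_nonneg _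
        have hp0 : (0 : ℝ) ≤ r.1.perceived y x := Nat.cast_nonneg _
        set e : ℝ := (s.deg y : ℝ) - 1 with hedef
        have he0 : 0 ≤ e := by linarith
        have hK1 : (P.width : ℝ) + 1 ≤ P.width * (1 + P.eps / 128) := by linarith
        set q : ℝ := P.eps with hq
        -- The factors are, from outside in: the position of y (at most d(x)), the staleness of the
        -- perceived value, the bucket width, and the failed test. The first three multiply to at
        -- most 1+ε/16, which the passage from ε/2 to ε absorbs.
        have h₄ : (1 + q / 128) * ((1 + q / 128) * ((1 + q / 64) * ((1 + q / 2) * e + 1))) ≤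
            (1 + q) * e + 2 := by
          have h₅ : (1 + q / 128) * ((1 + q / 128) * (1 + q / 64)) ≤ 1 + q / 16 := by
            have : 0 ≤ q / 128 * (4 - 5 * (q / 128) - 2 * (q / 128) ^ 2) :=
              mul_nonneg (by positivity) (by nlinarith)
            linarith
          have h₆ : 0 ≤ (1 + q / 2) * e + 1 := by positivity
          have h₇ := mul_le_mul_of_nonneg_right h₅ h₆
          have h₈ : (1 + q / 16) * ((1 + q / 2) * e + 1) ≤ (1 + q) * e + 2 := by
            have : 0 ≤ q * (7 / 16 - q / 32) * e :=
              mul_nonneg (mul_nonneg hε.le (by linarith)) he0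
            nlinarith
          linarith
        calc (P.width : ℝ) * s.deg x + (r.1.checkList x).idxOf y
            ≤ (P.width + 1) * s.deg x := by linarith
          _ ≤ (P.width * (1 + q / 128)) * s.deg x := by gcongr
          _ = (1 + q / 128) * (P.width * s.deg x) := by ring
          _ ≤ (1 + q / 128) * ((P.width + 1) * r.1.perceived y x) := by gcongr
          _ ≤ (1 + q / 128) * ((P.width * (1 + q / 128)) *
              ((1 + q / 64) * ((1 + q / 2) * e + 1))) := by gcongr
          _ = P.width * ((1 + q / 128) *
              ((1 + q / 128) * ((1 + q / 64) * ((1 + q / 2) * e + 1)))) := by ring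
          _ ≤ _ := by gcongr
      · rw [Function.update_of_ne hyu]
        refine le_trans ?_ (hr.balanced x y hxy)
        gcongr
        rcases eq_or_ne x u with rfl | hxu
        · rw [Function.update_self]
          exact Nat.sub_le _ _
        · rw [Function.update_of_ne hxu]
    have hrd1 : 1 ≤ r.1.deg u := by rwa [hrd]
    obtain ⟨hq, hqc, hqt⟩ := hr.setDegree hP (d := r.1.deg u - 1) (by omega) (by norm_num)
      (by norm_num) hb
    refine ⟨1, _, _, by simp only [deleteCopy, ← hrdef, hx]; rfl, hq, fun x y => ?_, ?_⟩
    · rw [hqc, hrc]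
      exact hpair x y
    · have h₁ : 2 + r.2 + (DynOrient.setDegree P r.1 u (r.1.deg u - 1)).2 ≤ callCost P n := by
        unfold callCost
        omega
      have h₂ : potential P ((s.deg u : ℝ) - 1) ≤ potential P D :=
        potential_mono hP (by linarith) (by
          have : (s.deg u : ℝ) ≤ D := by exact_mod_cast hD u
          linarith)
      refine (Nat.cast_le.2 h₁).trans ?_
      nlinarith
  | some x =>
    obtain ⟨hxu, hlt⟩ := mem_of_heavyInNeighbour hx
    rw [hr.mem_inList] at hxu
    rw [hrd, hP.theta_eq, Nat.cast_one, ← he] at hlt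
    have hcl := (Nat.le_add_right _ _).trans (hr.close x u hxu).2
    obtain ⟨hg₁, hg₂⟩ := growth_of_heavy hP hcl hlt
    rw [hrd] at hg₁ hg₂
    have hux : s.deg u < s.deg x := by omega
    obtain ⟨ha, had, hac, hat⟩ := hr.addCopy hP (by norm_num) (hr.ne hxu).symm
      (by rw [hrd]; exact hux.le)
    set a := DynOrient.addCopy P r.1 u x with hadef
    have hda : a.1.deg = s.deg := had.trans hrd
    rw [show (0 : ℤ) - 1 + 1 = 0 by norm_num] at ha
    have hax : 0 < a.1.copies x u := by
      rw [hac, set₂_apply, if_neg (fun h => hr.ne hxu h.1)]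
      exact hxu
    have hxD := hD x
    obtain ⟨depth, s', t, hs', hi, hp, ht⟩ := ih (D - a.1.deg x) (by rw [hda]; omega)
      (ha.switch x) hax (by rw [hda]; exact hD) rfl
    refine ⟨depth + 1, s', 2 + r.2 + a.2 + t, ?_, hi.switch u, fun y z => ?_, ?_⟩
    · simp only [deleteCopy]
      rw [← hrdef]
      simp only [hx]
      rw [← hadef, hs']
      rfl
    · have h₁ := set₂_add_set₂ (c := r.1.copies) (hr.ne hxu).symm (k := 0) (l := 1)
        (a := r.1.copies u x + 1) (by omega) y z
      have h₂ := hp y z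
      have h₃ := hpair y z
      rw [edgeIndicator_comm x u] at h₂
      rw [hac] at h₂
      rw [← hrc] at h₃
      omega
    · have h₁ : 2 + r.2 + a.2 ≤ callCost P n := by
        unfold callCost
        omega
      have h₂ : ((2 + r.2 + a.2 : ℕ) : ℝ) ≤ callCost P n := Nat.cast_le.2 h₁
      rw [hda] at ht
      have h₃ : potential P ((s.deg u : ℝ) - 1) + 1 ≤ potential P ((s.deg x : ℝ) - 1) := by
        rw [he] at hg₂
        have : (s.deg u : ℝ) + 1 ≤ s.deg x := by exact_mod_cast hux
        exact potential_add_one_le hP (by linarith) (by linarith) hg₂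
      have h₄ := mul_le_mul_of_nonneg_left h₃ hcost
      rw [Nat.cast_add]
      linarith

/-! ### All copies of one edge. -/

/-- M dominates the pair counts throughout, so `hD` gives the same degree bound D before every
single copy. -/
theorem insertCopies_spec {P : Params} (hP : P.Admissible) {D : ℕ} {M : Fin n → Fin n → ℕ}
    {u v : Fin n} (huv : u ≠ v)
    (hD : ∀ s : State n, Invariant P s u 0 →
      (∀ x y, s.copies x y + s.copies y x ≤ M x y) → ∀ w, s.deg w ≤ D)
    (k : ℕ) {s : State n} (h : Invariant P s u 0)
    (hM : ∀ x y, s.copies x y + s.copies y x + k * edgeIndicator u v x y ≤ M x y) :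
    ∃ depth s' t, insertCopies P depth u v k s = some (s', t) ∧ Invariant P s' u 0 ∧
      (∀ x y, s'.copies x y + s'.copies y x =
        s.copies x y + s.copies y x + k * edgeIndicator u v x y) ∧
      (t : ℝ) ≤ k * (1 + callCost P n * (potential P D + 1)) := by
  induction k generalizing s with
  | zero => exact ⟨0, s, 0, rfl, h, by simp, by simp⟩
  | succ k ih =>
    have hdeg := hD s h (fun x y => (Nat.le_add_right _ _).trans (hM x y))
    have hstep : ∃ depth s' t, (if s.deg u ≤ s.deg v then insertCopy P depth s u v
        else insertCopy P depth s v u) = some (s', t) ∧ Invariant P s' u 0 ∧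
        (∀ x y, s'.copies x y + s'.copies y x =
          s.copies x y + s.copies y x + edgeIndicator u v x y) ∧
        (t : ℝ) ≤ callCost P n * (potential P D + 1) := by
      have hpot : ∀ w, (callCost P n : ℝ) * (potential P (s.deg w) + 1) ≤
          callCost P n * (potential P D + 1) := fun w =>
        mul_le_mul_of_nonneg_left (by
          have := potential_mono hP (Nat.cast_nonneg _) (Nat.cast_le (α := ℝ).2 (hdeg w))
          linarith) (Nat.cast_nonneg _)
      split_ifs with hd
      · obtain ⟨e, s', t, h₁, h₂, h₃, h₄⟩ := insertCopy_spec hP h huv hd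
        exact ⟨e, s', t, h₁, h₂, h₃, h₄.trans (hpot u)⟩
      · obtain ⟨e, s', t, h₁, h₂, h₃, h₄⟩ :=
          insertCopy_spec hP (h.switch v) huv.symm (not_le.1 hd).le
        refine ⟨e, s', t, h₁, h₂.switch u, fun x y => ?_, h₄.trans (hpot v)⟩
        rw [edgeIndicator_comm u v]
        exact h₃ x y
    obtain ⟨e, s', t, h₁, h₂, h₃, h₄⟩ := hstep
    obtain ⟨e', s'', t', h₅, h₆, h₇, h₈⟩ := ih h₂ (fun x y => by
      have := hM x y
      rw [add_mul, one_mul] at this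
      rw [h₃]
      omega)
    refine ⟨e + e', s'', 1 + t + t', ?_, h₆, fun x y => ?_, ?_⟩
    · have h₉ : (if s.deg u ≤ s.deg v then insertCopy P (e + e') s u v
          else insertCopy P (e + e') s v u) = some (s', t) := by
        split_ifs at h₁ ⊢ <;> exact insertCopy_mono P h₁ e'
      rw [insertCopies, h₉, Option.bind_some, add_comm e, insertCopies_mono P h₅ e]
      rfl
    · rw [h₇, h₃]
      ring
    · push_cast
      linarith

theorem deleteCopies_spec {P : Params} (hP : P.Admissible) {D : ℕ} {M : Fin n → Fin n → ℕ}
    {u v : Fin n}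
    (hD : ∀ s : State n, Invariant P s u 0 →
      (∀ x y, s.copies x y + s.copies y x ≤ M x y) → ∀ w, s.deg w ≤ D)
    (k : ℕ) {s : State n} (h : Invariant P s u 0)
    (hM : ∀ x y, s.copies x y + s.copies y x ≤ M x y) (hk : k ≤ s.copies u v + s.copies v u) :
    ∃ depth s' t, deleteCopies P depth u v k s = some (s', t) ∧ Invariant P s' u 0 ∧
      (∀ x y, s'.copies x y + s'.copies y x + k * edgeIndicator u v x y =
        s.copies x y + s.copies y x) ∧
      (t : ℝ) ≤ k * (1 + callCost P n * (potential P D + 1)) := by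
  induction k generalizing s with
  | zero => exact ⟨0, s, 0, rfl, h, by simp, by simp⟩
  | succ k ih =>
    have hdeg := hD s h hM
    have hstep : ∃ depth s' t, (if 0 < s.copies u v then deleteCopy P depth s u v
        else deleteCopy P depth s v u) = some (s', t) ∧ Invariant P s' u 0 ∧
        (∀ x y, s'.copies x y + s'.copies y x + edgeIndicator u v x y =
          s.copies x y + s.copies y x) ∧
        (t : ℝ) ≤ callCost P n * (potential P D + 1) := by
      have hpot : ∀ w, 0 < s.deg w →
          (callCost P n : ℝ) * (potential P D - potential P ((s.deg w : ℝ) - 1) + 1) ≤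
          callCost P n * (potential P D + 1) := fun w hw =>
        mul_le_mul_of_nonneg_left (by
          have h₁ : (1 : ℝ) ≤ s.deg w := by exact_mod_cast hw
          have := potential_nonneg hP (sub_nonneg.2 h₁)
          linarith) (Nat.cast_nonneg _)
      have hpos : ∀ x y, 0 < s.copies x y → 0 < s.deg x := fun x y hxy => by
        rw [← h.deg_eq x]
        exact hxy.trans_le (Finset.single_le_sum (f := s.copies x) (fun _ _ => Nat.zero_le _)
          (Finset.mem_univ y))
      split_ifs with hc
      · obtain ⟨e, s', t, h₁, h₂, h₃, h₄⟩ := deleteCopy_spec hP h hc hdeg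
        exact ⟨e, s', t, h₁, h₂, h₃, h₄.trans (hpot u (hpos u v hc))⟩
      · have hc' : 0 < s.copies v u := by omega
        obtain ⟨e, s', t, h₁, h₂, h₃, h₄⟩ := deleteCopy_spec hP (h.switch v) hc' hdeg
        refine ⟨e, s', t, h₁, h₂.switch u, fun x y => ?_, h₄.trans (hpot v (hpos v u hc'))⟩
        rw [edgeIndicator_comm u v]
        exact h₃ x y
    obtain ⟨e, s', t, h₁, h₂, h₃, h₄⟩ := hstep
    obtain ⟨e', s'', t', h₅, h₆, h₇, h₈⟩ := ih h₂
      (fun x y => (Nat.le_add_right _ _).trans ((h₃ x y).trans_le (hM x y))) (by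
        have := h₃ u v
        simp only [edgeIndicator, and_self, true_or, if_true] at this
        omega)
    refine ⟨e + e', s'', 1 + t + t', ?_, h₆, fun x y => ?_, ?_⟩
    · have h₉ : (if 0 < s.copies u v then deleteCopy P (e + e') s u v
          else deleteCopy P (e + e') s v u) = some (s', t) := by
        split_ifs at h₁ ⊢ <;> exact deleteCopy_mono P h₁ e'
      rw [deleteCopies, h₉, Option.bind_some, add_comm e, deleteCopies_mono P h₅ e]
      rfl
    · rw [← h₃ x y, ← h₇ x y]
      ring
    · push_cast
      linarith

/-! ### Density and the bound on out-degrees. -/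

theorem maxDensity_nonneg (G : SimpleGraph (Fin n)) : 0 ≤ maxDensity G := by
  refine le_trans (le_of_eq ?_) (le_ciSup (Set.finite_range _).bddAbove (∅ : Finset (Fin n)))
  simp

theorem ncard_le_maxDensity_mul (G : SimpleGraph (Fin n)) (T : Finset (Fin n))
    (hT : T.Nonempty) :
    (({e ∈ G.edgeSet | ∀ x ∈ e, x ∈ T}.ncard : ℕ) : ℝ) ≤ maxDensity G * T.card := by
  rw [← div_le_iff₀ (by exact_mod_cast hT.card_pos)]
  exact le_ciSup (f := fun S : Finset (Fin n) =>
    ({e ∈ G.edgeSet | ∀ x ∈ e, x ∈ S}.ncard : ℝ) / (S.card : ℝ)) (Set.finite_range _).bddAbove T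

/-- One more edge adds at most 1 to |E[S]|, and |S| ≥ 1. This lets a deletion, whose degrees are
bounded through the old graph, be charged to the new density. -/
theorem maxDensity_le_add_one {G G' : SimpleGraph (Fin n)} {e : Sym2 (Fin n)}
    (h : G.edgeSet ⊆ insert e G'.edgeSet) : maxDensity G ≤ maxDensity G' + 1 := by
  refine ciSup_le fun T => ?_
  rcases T.eq_empty_or_nonempty with rfl | hT
  · have := maxDensity_nonneg G'
    simp only [Finset.card_empty, Nat.cast_zero, div_zero]
    linarith
  have hc : (1 : ℝ) ≤ T.card := by exact_mod_cast hT.card_pos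
  rw [div_le_iff₀ (by linarith)]
  have h₁ : {e ∈ G.edgeSet | ∀ x ∈ e, x ∈ T}.ncard ≤
      {e ∈ G'.edgeSet | ∀ x ∈ e, x ∈ T}.ncard + 1 := by
    refine (Set.ncard_le_ncard (t := insert e {e ∈ G'.edgeSet | ∀ x ∈ e, x ∈ T}) ?_
      (Set.toFinite _)).trans (Set.ncard_insert_le _ _)
    rintro f ⟨hf, hfT⟩
    exact (h hf).imp id fun hf' => ⟨hf', hfT⟩
  have h₂ := ncard_le_maxDensity_mul G' T hT
  have h₃ : ({e ∈ G.edgeSet | ∀ x ∈ e, x ∈ T}.ncard : ℝ) ≤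
      {e ∈ G'.edgeSet | ∀ x ∈ e, x ∈ T}.ncard + 1 := by exact_mod_cast h₁
  linarith

open Classical in
-- Group the ordered pairs by the edge they span. The hypothesis is an inequality so that it also
-- covers states in which only some copies of an edge are present.
theorem sum_copies_le (G : SimpleGraph (Fin n)) (b : ℕ) (c : Fin n → Fin n → ℕ)
    (hc : ∀ x y, c x y + c y x ≤ if G.Adj x y then b else 0) (T : Finset (Fin n)) :
    ∑ x ∈ T, ∑ y ∈ T, c x y ≤ b * {e ∈ G.edgeSet | ∀ x ∈ e, x ∈ T}.ncard := by
  set E : Set (Sym2 (Fin n)) := {e ∈ G.edgeSet | ∀ x ∈ e, x ∈ T}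
  have hpos : ∀ x y, ¬ G.Adj x y → c x y = 0 := fun x y h => by
    have := hc x y
    rw [if_neg h] at this
    omega
  rw [← Finset.sum_product', Set.ncard_eq_toFinset_card', mul_comm, ← smul_eq_mul,
    ← Finset.sum_filter_of_ne (p := fun p : Fin n × Fin n => G.Adj p.1 p.2)
      (fun p _ hp => by_contra fun h => hp (hpos _ _ h))]
  rw [← Finset.sum_fiberwise_of_maps_to (t := E.toFinset) (g := fun p => s(p.1, p.2))]
  · refine Finset.sum_le_card_nsmul _ _ _ fun e _ => ?_
    induction e with
    | _ x y =>
    by_cases hxy : G.Adj x y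
    · refine (Finset.sum_le_sum_of_subset (t := {(x, y), (y, x)}) ?_).trans ?_
      · rintro ⟨a, a'⟩ ha
        simp only [Finset.mem_filter, Sym2.eq_iff] at ha
        simpa using ha.2
      · rw [Finset.sum_pair (by simp [hxy.ne])]
        have := hc x y
        rwa [if_pos hxy] at this
    · rw [Finset.sum_eq_zero]
      · exact Nat.zero_le _
      rintro ⟨a, a'⟩ ha
      simp only [Finset.mem_filter] at ha
      refine absurd ?_ hxy
      rw [← SimpleGraph.mem_edgeSet, ← ha.2, SimpleGraph.mem_edgeSet]
      exact ha.1.2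
  · rintro ⟨x, y⟩ hp
    simp only [Finset.mem_filter, Finset.mem_product] at hp
    simp only [E, Set.mem_toFinset, Set.mem_ofPred_eq, SimpleGraph.mem_edgeSet, Sym2.mem_iff]
    exact ⟨hp.2, by rintro z (rfl | rfl); exacts [hp.1.1, hp.1.2]⟩

open Classical in
/-- The sets of vertices whose out-degree exceeds a slowly growing threshold shrink geometrically. -/
theorem exists_threshold (G : SimpleGraph (Fin n)) (c : Fin n → Fin n → ℕ)
    (hc : ∀ x y, c x y + c y x ≤ if G.Adj x y then 6 else 0) {ε : ℝ} (hε : 0 ≤ ε)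
    (hbal : ∀ x y, 0 < c x y →
      (multiOutDegree c x : ℝ) ≤ (1 + ε) * multiOutDegree c y + 2) (k : ℕ) :
    ∃ a : ℝ, 12 * maxDensity G + 1 ≤ a ∧ a ≤ (1 + ε) ^ k * (12 * maxDensity G + 1 + 2 * k) ∧
      (Finset.univ.filter fun x => a < multiOutDegree c x).card * 2 ^ k ≤ n := by
  have hρ := maxDensity_nonneg G
  induction k with
  | zero =>
    refine ⟨_, le_rfl, by simp, ?_⟩
    rw [pow_zero, mul_one]
    exact (Finset.card_le_univ _).trans_eq (Fintype.card_fin n)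
  | succ k ih =>
    obtain ⟨a, h₁, h₂, h₃⟩ := ih
    have ha0 : 0 ≤ a := by linarith
    have haa : a ≤ (1 + ε) * a + 2 := by nlinarith
    refine ⟨(1 + ε) * a + 2, h₁.trans haa, ?_, ?_⟩
    · have h₄ : (1 : ℝ) ≤ (1 + ε) ^ (k + 1) := one_le_pow₀ (by linarith)
      have h₅ := mul_le_mul_of_nonneg_left h₂ (show 0 ≤ 1 + ε by linarith)
      rw [pow_succ'] at h₄ ⊢
      push_cast
      linarith
    set T := Finset.univ.filter fun x => a < multiOutDegree c x
    set U := Finset.univ.filter fun x => (1 + ε) * a + 2 < multiOutDegree c x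
    have hUT : U ⊆ T := fun x hx => by
      simp only [U, T, Finset.mem_filter, Finset.mem_univ, true_and] at hx ⊢
      linarith
    suffices h : 2 * U.card ≤ T.card by
      calc U.card * 2 ^ (k + 1) = 2 * U.card * 2 ^ k := by ring
        _ ≤ T.card * 2 ^ k := Nat.mul_le_mul_right _ h
        _ ≤ n := h₃
    rcases T.eq_empty_or_nonempty with hT | hT
    · rw [hT, Finset.subset_empty] at hUT
      simp [hUT]
    have hout : ∀ x ∈ U, ∀ y, 0 < c x y → y ∈ T := fun x hx y hxy => by
      simp only [U, T, Finset.mem_filter, Finset.mem_univ, true_and] at hx ⊢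
      have := hbal x y hxy
      have h₄ : (1 + ε) * a < (1 + ε) * multiOutDegree c y := by linarith
      exact lt_of_mul_lt_mul_left h₄ (by linarith)
    have hsum : ∑ x ∈ U, multiOutDegree c x ≤ ∑ x ∈ T, ∑ y ∈ T, c x y := by
      refine le_trans (Finset.sum_le_sum fun x hx => le_of_eq ?_)
        (Finset.sum_le_sum_of_subset hUT)
      symm
      refine Finset.sum_subset (Finset.subset_univ T) fun y _ hy => ?_
      by_contra h
      exact hy (hout x hx y (Nat.pos_of_ne_zero h))
    have h₄ : (U.card : ℝ) * (12 * maxDensity G + 1) ≤ ∑ x ∈ U, (multiOutDegree c x : ℝ) := by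
      rw [← nsmul_eq_mul]
      refine Finset.card_nsmul_le_sum _ _ _ fun x hx => ?_
      simp only [U, Finset.mem_filter, Finset.mem_univ, true_and] at hx
      linarith
    have h₅ : (∑ x ∈ U, (multiOutDegree c x : ℝ)) ≤
        6 * ({e ∈ G.edgeSet | ∀ x ∈ e, x ∈ T}.ncard : ℝ) := by
      exact_mod_cast hsum.trans (sum_copies_le G 6 c hc T)
    have h₆ := ncard_le_maxDensity_mul G T hT
    -- By double counting, |U|(12ρ+1) ≤ 6ρ|T|, and 12ρ ≤ 12ρ+1. The added 1 keeps the factor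
    -- positive when ρ = 0.
    have h₇ : (2 * U.card : ℝ) * (12 * maxDensity G + 1) ≤
        T.card * (12 * maxDensity G + 1) := by
      have : (0 : ℝ) ≤ T.card := Nat.cast_nonneg _
      linarith
    have h₈ := le_of_mul_le_mul_right h₇ (by linarith)
    exact_mod_cast h₈

/-- The constant 29/20 is slightly more than 1/log 2; additive constants are absorbed into
logarithms this way. -/
theorem one_le_mul_log {x : ℝ} (hx : 2 ≤ x) : 1 ≤ 29 / 20 * Real.log x := by
  have h₁ := Real.log_two_gt_d9
  have h₂ := Real.log_le_log (by norm_num) hx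
  linarith

theorem natLog_le {n : ℕ} (hn : 2 ≤ n) : (Nat.log 2 n : ℝ) ≤ 29 / 20 * Real.log n := by
  have h₁ : ((2 ^ Nat.log 2 n : ℕ) : ℝ) ≤ n := Nat.cast_le.2 (Nat.pow_log_le_self 2 (by omega))
  have h₂ := Real.log_le_log (by positivity) h₁
  rw [Nat.cast_pow, Real.log_pow, Nat.cast_ofNat] at h₂
  have h₃ := one_le_mul_log le_rfl
  have h₄ : (0 : ℝ) ≤ Nat.log 2 n := Nat.cast_nonneg _
  nlinarith

open Classical in
theorem multiOutDegree_le (hn : 2 ≤ n) (G : SimpleGraph (Fin n)) (c : Fin n → Fin n → ℕ)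
    (hc : ∀ x y, c x y + c y x ≤ if G.Adj x y then 6 else 0) {ε : ℝ} (hε : 0 ≤ ε)
    (hε' : ε * Real.log n ≤ 1)
    (hbal : ∀ x y, 0 < c x y →
      (multiOutDegree c x : ℝ) ≤ (1 + ε) * multiOutDegree c y + 2) (x : Fin n) :
    (multiOutDegree c x : ℝ) ≤ 252 * (maxDensity G + Real.log n) := by
  have hρ := maxDensity_nonneg G
  have hn' : (2 : ℝ) ≤ n := by exact_mod_cast hn
  obtain ⟨a, -, h₂, h₃⟩ := exists_threshold G c hc hε hbal (Nat.log 2 n + 1)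
  -- Since 2^(log₂ n + 1) > n, no vertex exceeds the last threshold.
  have h₄ : (multiOutDegree c x : ℝ) ≤ a := by
    by_contra! h
    have h₅ : 1 ≤ (Finset.univ.filter fun x => a < multiOutDegree c x).card :=
      Finset.card_pos.2 ⟨x, by simpa using h⟩
    have h₆ := Nat.lt_pow_succ_log_self (b := 2) (by norm_num) n
    have h₇ := Nat.mul_le_mul_right (2 ^ (Nat.log 2 n + 1)) h₅
    omega
  have hl := one_le_mul_log hn'
  have hk : ((Nat.log 2 n + 1 : ℕ) : ℝ) ≤ 3 * Real.log n := by
    have := natLog_le hn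
    push_cast
    linarith
  -- The bound 21 exceeds e³, and 252 = 21 · 12.
  have hpow : (1 + ε) ^ (Nat.log 2 n + 1) ≤ 21 := by
    calc (1 + ε) ^ (Nat.log 2 n + 1) ≤ Real.exp ε ^ (Nat.log 2 n + 1) := by
          gcongr
          linarith [Real.add_one_le_exp ε]
      _ = Real.exp ((Nat.log 2 n + 1 : ℕ) * ε) := (Real.exp_nat_mul _ _).symm
      _ ≤ Real.exp ((3 : ℕ) * 1) := by
          refine Real.exp_le_exp.2 ?_
          have := mul_le_mul_of_nonneg_right hk hε
          push_cast at this ⊢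
          linarith
      _ = Real.exp 1 ^ 3 := Real.exp_nat_mul _ _
      _ ≤ 2.719 ^ 3 := by
          gcongr
          linarith [Real.exp_one_lt_d9]
      _ ≤ 21 := by norm_num
  have h₈ : 0 ≤ 12 * maxDensity G + 1 + 2 * ((Nat.log 2 n + 1 : ℕ) : ℝ) := by positivity
  have h₉ := mul_le_mul_of_nonneg_right hpow h₈
  linarith

/-! ### Rounding and a single update. -/

open Classical in
theorem isMultiOrientation_iff {b : ℕ} {G : SimpleGraph (Fin n)} {c : Fin n → Fin n → ℕ} :
    IsMultiOrientation b G c ↔ ∀ x y, c x y + c y x = if G.Adj x y then b else 0 := by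
  constructor
  · intro h x y
    split_ifs with hxy
    · exact (h x y).1 hxy
    · rw [(h x y).2 hxy, (h y x).2 (fun h => hxy h.symm)]
  · intro h x y
    have := h x y
    refine ⟨fun hxy => by rwa [if_pos hxy] at this, fun hxy => ?_⟩
    rw [if_neg hxy] at this
    omega

theorem isOrientation_rounded {b : ℕ} (hb : 0 < b) {G : SimpleGraph (Fin n)}
    {c : Fin n → Fin n → ℕ} (h : IsMultiOrientation b G c) : IsOrientation G (rounded c) := by
  intro u v
  have h₁ := h u v
  have h₂ := (h v u).2
  unfold rounded
  by_cases huv : G.Adj u v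
  · have h₃ := h₁.1 huv
    have h₄ := huv.ne
    refine ⟨⟨fun _ => ?_, fun _ => huv⟩, ?_⟩
    · rcases lt_trichotomy (c v u) (c u v) with h | h | h
      · exact Or.inl (Or.inl h)
      · rcases lt_or_gt_of_ne h₄ with h' | h'
        · exact Or.inl (Or.inr ⟨h, by omega, h'⟩)
        · exact Or.inr (Or.inr ⟨h.symm, by omega, h'⟩)
      · exact Or.inr (Or.inl h)
    · rintro ⟨h | ⟨h, -, h'⟩, h'' | ⟨h'', -, h'''⟩⟩
      · omega
      · omega
      · omega
      · exact lt_asymm h' h'''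
  · have h₃ := h₁.2 huv
    have h₄ := h₂ (fun h => huv h.symm)
    simp [huv, h₃, h₄]

theorem outDegree_rounded_le (c : Fin n → Fin n → ℕ) (u : Fin n) :
    outDegree (rounded c) u ≤ multiOutDegree c u := by
  classical
  unfold outDegree multiOutDegree
  rw [Set.ncard_eq_toFinset_card', Finset.card_eq_sum_ones]
  refine (Finset.sum_le_sum (f := fun _ => 1) (g := c u) fun v hv => ?_).trans
    (Finset.sum_le_sum_of_subset (Finset.subset_univ _))
  have hv' : rounded c u v := by simpa using hv
  rcases hv' with h | h <;> omega

theorem Invariant.empty (P : Params) (u : Fin n) : Invariant P (State.empty n) u 0 where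
  loopless _ := rfl
  check _ := by simp [State.empty]
  inform _ := by simp [State.empty]
  sorted _ := by simp [State.empty]
  mem_inList _ _ := by simp [State.empty]
  sum_copies _ := by simp [State.empty]
  balanced _ _ h := absurd h (lt_irrefl 0)
  close _ _ h := absurd h (lt_irrefl 0)

theorem Invariant.multiOutDegree_eq {P : Params} {s : State n} {u : Fin n}
    (h : Invariant P s u 0) (x : Fin n) : multiOutDegree s.copies x = s.deg x := h.deg_eq x

theorem Invariant.multiOutDegree_le {P : Params} (hP : P.Admissible) {s : State n} {u : Fin n}
    (h : Invariant P s u 0) {x y : Fin n} (hc : 0 < s.copies x y) :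
    (multiOutDegree s.copies x : ℝ) ≤ (1 + P.eps) * multiOutDegree s.copies y + 2 := by
  rw [h.multiOutDegree_eq, h.multiOutDegree_eq]
  have hK : (0 : ℝ) < P.width := by exact_mod_cast hP.width_pos
  refine le_of_mul_le_mul_left (le_trans ?_ (h.balanced x y hc)) hK
  exact le_add_of_nonneg_right (Nat.cast_nonneg _)

open Classical in
theorem Invariant.deg_le {P : Params} (hP : P.Admissible) (hn : 2 ≤ n)
    (hε : P.eps * Real.log n ≤ 1) {s : State n} {u : Fin n} (h : Invariant P s u 0)
    {G : SimpleGraph (Fin n)}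
    (hc : ∀ x y, s.copies x y + s.copies y x ≤ if G.Adj x y then 6 else 0) (x : Fin n) :
    s.deg x ≤ ⌊252 * (maxDensity G + Real.log n)⌋₊ := by
  refine Nat.le_floor ?_
  rw [← h.multiOutDegree_eq]
  exact DynOrient.multiOutDegree_le hn G _ hc hP.eps_pos.le hε
    (fun x y hxy => h.multiOutDegree_le hP hxy) x

/-- One update preserves the invariants, and its time is bounded by the depth of the recursion. -/
theorem exists_runs {P : Params} (hP : P.Admissible) (hb : P.b = 6) (hn : 2 ≤ n)
    (hε : P.eps * Real.log n ≤ 1) {G G' : SimpleGraph (Fin n)} {op : Update n} {s : State n}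
    (h : ∀ u, Invariant P s u 0) (hG : IsMultiOrientation 6 G s.copies) (hop : op.Takes G G') :
    ∃ s' t, Runs P s op s' t ∧ (∀ u, Invariant P s' u 0) ∧ IsMultiOrientation 6 G' s'.copies ∧
      (t : ℝ) ≤ 6 * (1 + callCost P n *
        (potential P (252 * (maxDensity G' + 1 + Real.log n)) + 1)) := by
  classical
  have hlog : 0 ≤ Real.log n := Real.log_natCast_nonneg n
  have hpot : ∀ H : SimpleGraph (Fin n), maxDensity H ≤ maxDensity G' + 1 → ∀ t : ℕ,
      (t : ℝ) ≤ (6 : ℕ) * (1 + callCost P n *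
        (potential P (⌊252 * (maxDensity H + Real.log n)⌋₊ : ℕ) + 1)) →
      (t : ℝ) ≤ 6 * (1 + callCost P n *
        (potential P (252 * (maxDensity G' + 1 + Real.log n)) + 1)) := by
    intro H hH t ht
    have h₀ := maxDensity_nonneg H
    refine ht.trans ?_
    rw [Nat.cast_ofNat]
    gcongr
    refine potential_mono hP (Nat.cast_nonneg _) ((Nat.floor_le (by positivity)).trans ?_)
    linarith
  rw [isMultiOrientation_iff] at hG
  cases op with
  | insert u v =>
    obtain ⟨huv, hadj, hG'⟩ := hop
    have hsum : ∀ x y, s.copies x y + s.copies y x + 6 * edgeIndicator u v x y =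
        if G'.Adj x y then 6 else 0 := by
      intro x y
      rw [hG]
      subst hG'
      simp only [SimpleGraph.sup_adj, SimpleGraph.edge_adj, edgeIndicator]
      by_cases h₁ : (x = u ∧ y = v) ∨ (x = v ∧ y = u)
      · have h₂ : ¬ G.Adj x y := by
          rcases h₁ with ⟨rfl, rfl⟩ | ⟨rfl, rfl⟩
          · exact hadj
          · exact fun h => hadj h.symm
        have h₃ : x ≠ y := by
          rcases h₁ with ⟨rfl, rfl⟩ | ⟨rfl, rfl⟩
          · exact huv
          · exact huv.symm
        simp [h₂, h₃, h₁]
      · simp [h₁]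
    -- While copies are being inserted, the new graph dominates all pair counts.
    obtain ⟨depth, s', t, h₁, h₂, h₃, h₄⟩ := insertCopies_spec hP huv
      (fun s hs hM => hs.deg_le (G := G') hP hn hε hM) 6 (h u) (fun x y => (hsum x y).le)
    refine ⟨s', t, ⟨depth, by rw [process, hb]; exact h₁⟩, h₂.switch, ?_,
      hpot _ (by linarith) t h₄⟩
    rw [isMultiOrientation_iff]
    intro x y
    rw [h₃, hsum]
  | delete u v =>
    obtain ⟨hadj, rfl⟩ := hop
    have huv := hadj.ne
    have hGuv := hG u v
    rw [if_pos hadj] at hGuv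
    -- While copies are being deleted, the old graph dominates, at the price of 1 in the density.
    obtain ⟨depth, s', t, h₁, h₂, h₃, h₄⟩ := deleteCopies_spec hP
      (fun s hs hM => hs.deg_le hP hn hε hM) 6 (h u) (fun x y => (hG x y).le) hGuv.ge
    refine ⟨s', t, ⟨depth, by rw [process, hb]; exact h₁⟩, h₂.switch, ?_,
      hpot G (maxDensity_le_add_one (e := s(u, v)) ?_) t h₄⟩
    · rw [isMultiOrientation_iff]
      intro x y
      have h₅ := h₃ x y
      rw [hG] at h₅
      simp only [SimpleGraph.sdiff_adj, SimpleGraph.edge_adj]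
      simp only [edgeIndicator] at h₅
      by_cases h₁ : (x = u ∧ y = v) ∨ (x = v ∧ y = u)
      · have h₂ : G.Adj x y ∧ x ≠ y := by
          rcases h₁ with ⟨rfl, rfl⟩ | ⟨rfl, rfl⟩
          · exact ⟨hadj, huv⟩
          · exact ⟨hadj.symm, huv.symm⟩
        simp only [h₁, h₂, if_true] at h₅
        simp [h₁, h₂.2]
        omega
      · simpa [h₁] using h₅
    · intro e he
      by_cases h₅ : e = s(u, v)
      · exact Or.inl h₅
      · right
        rw [SimpleGraph.edgeSet_sdiff]
        refine ⟨he, fun h₆ => h₅ ?_⟩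
        induction e with
        | _ x y =>
        rw [SimpleGraph.mem_edgeSet, SimpleGraph.edge_adj] at h₆
        rw [Sym2.eq_iff]
        exact h₆.1

/-! ### The running time in terms of n and ρ. -/

/-- The resulting bound on the number of steps, in terms of `n` and the density `ρ`. -/
theorem steps_le {P : Params} (hP : P.Admissible) (hn : 2 ≤ n) {κ ρ : ℝ} (hκ : 0 < κ)
    (hκε : κ / Real.log n ≤ P.eps) (hε : P.eps * Real.log n ≤ 1) (hρ : 0 ≤ ρ) :
    6 * (1 + callCost P n * (potential P (252 * (ρ + 1 + Real.log n)) + 1)) ≤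
      6 * (4 + (25 + 1280 / κ) * (352 / κ + 3)) * Real.log n ^ 2 * Real.log (ρ + 2) := by
  have hL := one_le_mul_log (x := n) (by exact_mod_cast hn)
  have hl := one_le_mul_log (x := ρ + 2) (by linarith)
  have hlog := natLog_le hn
  have hε0 := hP.eps_pos
  have hL0 : 0 < Real.log n := by linarith
  have hinv : 1 / P.eps ≤ Real.log n / κ := by
    rw [div_le_div_iff₀ hε0 hκ]
    rw [div_le_iff₀ hL0] at hκε
    linarith
  have hpot : potential P (252 * (ρ + 1 + Real.log n)) ≤
      352 / κ * Real.log n * Real.log (ρ + 2) := by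
    -- Because ε·log n ≤ 1, the left side is linear in ρ with absolute constants, below 2¹⁰(ρ+2).
    have h₁ : 1 + P.eps * (252 * (ρ + 1 + Real.log n)) ≤ (ρ + 2) ^ 11 := by
      have h₂ : P.eps ≤ 29 / 20 := by nlinarith
      have h₃ : P.eps * ρ ≤ 29 / 20 * ρ := mul_le_mul_of_nonneg_right h₂ hρ
      have h₄ : (2 : ℝ) ^ 10 ≤ (ρ + 2) ^ 10 := by
        gcongr
        linarith
      rw [pow_succ]
      refine le_trans ?_ (mul_le_mul_of_nonneg_right h₄ (show 0 ≤ ρ + 2 by linarith))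
      linarith
    have h₂ : Real.log (1 + P.eps * (252 * (ρ + 1 + Real.log n))) ≤ 11 * Real.log (ρ + 2) := by
      refine (Real.log_le_log (by positivity) h₁).trans_eq ?_
      rw [Real.log_pow]
      norm_num
    calc potential P (252 * (ρ + 1 + Real.log n))
        = 32 * (1 / P.eps) * Real.log (1 + P.eps * (252 * (ρ + 1 + Real.log n))) := by
          unfold potential
          ring
      _ ≤ 32 * (Real.log n / κ) * (11 * Real.log (ρ + 2)) :=
          mul_le_mul (by gcongr) h₂ (Real.log_nonneg (by
            have : 0 ≤ P.eps * (252 * (ρ + 1 + Real.log n)) := by positivity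
            linarith)) (by positivity)
      _ = _ := by ring
  have hcost : (callCost P n : ℝ) ≤ (25 + 1280 / κ) * Real.log n := by
    have h₁ : (P.width : ℝ) ≤ 128 / P.eps + 1 := (Nat.ceil_lt_add_one (by positivity)).le
    have h₂ : 128 / P.eps = 128 * (1 / P.eps) := by ring
    have h₃ : 1280 / κ * Real.log n = 1280 * (Real.log n / κ) := by ring
    unfold callCost
    push_cast
    linarith
  set L := Real.log n
  set l := Real.log (ρ + 2)
  have hl0 : 0 < l := by linarith
  have hLl : 1 ≤ 3 * (L * l) := by
    have := mul_le_mul hL hl zero_le_one (by positivity)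
    nlinarith [mul_pos hL0 hl0]
  have hLLl : 1 ≤ 4 * (L ^ 2 * l) := by
    have h₁ := mul_le_mul hL hL zero_le_one (by positivity)
    have h₂ := mul_le_mul h₁ hl zero_le_one (by positivity)
    have h₃ : 0 < L ^ 2 * l := by positivity
    linarith
  have h₁ : potential P (252 * (ρ + 1 + L)) + 1 ≤ (352 / κ + 3) * (L * l) := by linarith
  have h₂ : (callCost P n : ℝ) * (potential P (252 * (ρ + 1 + L)) + 1) ≤
      (25 + 1280 / κ) * L * ((352 / κ + 3) * (L * l)) := by
    refine mul_le_mul hcost h₁ ?_ (by positivity)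
    have := potential_nonneg hP (d := 252 * (ρ + 1 + L)) (by positivity)
    linarith
  linarith

end DynOrient

/-! ### The whole sequence of updates. -/

theorem mainTheorem2 (γ κ : ℝ) (hγ : 0 < γ) (hκ : 0 < κ) :
    ∃ C : ℝ, 0 < C ∧
      ∀ n : ℕ, 2 ≤ n → ∀ η : ℝ,
        κ / Real.log n ≤ η * (6 : ℝ)⁻¹ →
        η * (6 : ℝ)⁻¹ < 1 / (Real.log n * max γ⁻¹ 1) →
        ∀ (G : ℕ → SimpleGraph (Fin n)) (op : ℕ → DynOrient.Update n),
          G 0 = ⊥ → (∀ i, (op i).Takes (G i) (G (i + 1))) →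
          ∃ (S : ℕ → DynOrient.State n) (t : ℕ → ℕ),
            S 0 = DynOrient.State.empty n ∧
            ∀ i,
              -- the algorithm terminates on the update, after `t i` steps
              DynOrient.Runs ⟨6, η, 1⟩ (S i) (op i) (S (i + 1)) (t i) ∧
              -- it maintains an orientation of `G^b`, which satisfies the invariant
              DynOrient.IsMultiOrientation 6 (G (i + 1)) (S (i + 1)).copies ∧
              (∀ u v, 0 < (S (i + 1)).copies u v →
                (DynOrient.multiOutDegree (S (i + 1)).copies u : ℝ) ≤
                  (1 + η * (6 : ℝ)⁻¹) * (DynOrient.multiOutDegree (S (i + 1)).copies v : ℝ) + 2) ∧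
              -- and an orientation of `G`
              DynOrient.IsOrientation (G (i + 1)) (DynOrient.rounded (S (i + 1)).copies) ∧
              -- with small out-degrees
              (∀ u, (DynOrient.multiOutDegree (S (i + 1)).copies u : ℝ) ≤
                C * (DynOrient.maxDensity (G (i + 1)) + Real.log n)) ∧
              (∀ u, (DynOrient.outDegree (DynOrient.rounded (S (i + 1)).copies) u : ℝ) ≤
                C * (DynOrient.maxDensity (G (i + 1)) + Real.log n)) ∧
              -- in the claimed worst-case time
              (t i : ℝ) ≤
                C * (Real.log n) ^ 2 * Real.log (DynOrient.maxDensity (G (i + 1)) + 2) := by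
  classical
  open DynOrient in
  set A : ℝ := 6 * (4 + (25 + 1280 / κ) * (352 / κ + 3)) with hA
  have hA0 : 0 < A := by positivity
  refine ⟨252 + A, by positivity, fun n hn η hη₁ hη₂ G op hG₀ hop => ?_⟩
  have hL := one_le_mul_log (x := n) (by exact_mod_cast hn)
  have hL0 : 0 < Real.log n := by linarith
  set P : Params := ⟨6, η, 1⟩ with hPdef
  have heps : P.eps = η * (6 : ℝ)⁻¹ := by simp [hPdef, Params.eps]
  rw [← heps] at hη₁ hη₂ ⊢
  have hε0 : 0 < P.eps := (div_pos hκ hL0).trans_le hη₁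
  have hεL : P.eps * Real.log n ≤ 1 := by
    have h₁ : P.eps < 1 / Real.log n := hη₂.trans_le
      (one_div_le_one_div_of_le hL0 (le_mul_of_one_le_right hL0.le (le_max_right _ _)))
    rw [lt_div_iff₀ hL0] at h₁
    exact h₁.le
  -- From ε·log n ≤ 1 and 1 ≤ (29/20)·log n follows ε ≤ 29/20 < 3/2.
  have hP : P.Admissible := ⟨hε0, by nlinarith, rfl⟩
  -- The states are chosen in the subtype of good ones, so that the recursion carries the invariants
  -- from one update to the next.
  let Good (i : ℕ) (s : State n) : Prop :=
    (∀ u, Invariant P s u 0) ∧ IsMultiOrientation 6 (G i) s.copies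
  have hstep : ∀ i (s : {s // Good i s}), ∃ (s' : {s // Good (i + 1) s}) (t : ℕ),
      Runs P s.1 (op i) s'.1 t ∧ (t : ℝ) ≤
        A * Real.log n ^ 2 * Real.log (maxDensity (G (i + 1)) + 2) := by
    rintro i ⟨s, h₁, h₂⟩
    obtain ⟨s', t, h₃, h₄, h₅, h₆⟩ := exists_runs hP rfl hn hεL h₁ h₂ (hop i)
    exact ⟨⟨s', h₄, h₅⟩, t, h₃, h₆.trans (steps_le hP hn hκ hη₁ hεL (maxDensity_nonneg _))⟩
  choose next time hnext using hstep
  have h₀ : Good 0 (State.empty n) := by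
    refine ⟨Invariant.empty P, ?_⟩
    rw [hG₀]
    intro u v
    simp [State.empty]
  let T : (i : ℕ) → {s // Good i s} := fun i =>
    Nat.rec (motive := fun i => {s // Good i s}) ⟨State.empty n, h₀⟩ next i
  refine ⟨fun i => (T i).1, fun i => time i (T i), rfl, fun i => ?_⟩
  obtain ⟨hrun, ht⟩ := hnext i (T i)
  obtain ⟨hinv, hor⟩ := (T (i + 1)).2
  have hρ := maxDensity_nonneg (G (i + 1))
  have hl := one_le_mul_log (x := maxDensity (G (i + 1)) + 2) (by linarith)
  have hbal : ∀ u v, 0 < (T (i + 1)).1.copies u v →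
      (multiOutDegree (T (i + 1)).1.copies u : ℝ) ≤
        (1 + P.eps) * multiOutDegree (T (i + 1)).1.copies v + 2 :=
    fun u v huv => (hinv u).multiOutDegree_le hP huv
  have hdeg : ∀ u, (multiOutDegree (T (i + 1)).1.copies u : ℝ) ≤
      (252 + A) * (maxDensity (G (i + 1)) + Real.log n) := fun u => by
    refine (DynOrient.multiOutDegree_le hn (G (i + 1)) _
      (fun x y => (isMultiOrientation_iff.1 hor x y).le) hε0.le hεL hbal u).trans ?_
    gcongr
    linarith
  refine ⟨hrun, hor, hbal, isOrientation_rounded (by norm_num) hor, hdeg, fun u => ?_, ?_⟩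
  · exact (Nat.cast_le.2 (outDegree_rounded_le _ u)).trans (hdeg u)
  · refine ht.trans ?_
    have : 0 ≤ Real.log (maxDensity (G (i + 1)) + 2) := by linarith
    gcongr
    linarith
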